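/- **Conventions.** Let $A$ be a simple, separable, unital $C^*$-algebra, let $\mathcal K$ be the algebra of compact operators on $\ell^2(\mathbb N)$, and let $T(A)$ be the set of tracial states of $A$ with the weak$^*$ topology. Write $QT(A)$ for the set of normalized $2$-quasitraces on $A$. Here a quasitrace on a $C^*$-algebra $B$ is a function $\varphi\colon B\to\mathbb C$ with $\varphi(x^*x)=\varphi(xx^*)\ge 0$ for all $x\in B$ and $\varphi(a+ib)=\varphi(a)+i\varphi(b)$ for self-adjoint $a,b$ that is linear on commutative $C^*$-subalgebras; a normalized $2$-quasitrace on $A$ is a quasitrace $\varphi$ with $\varphi(1)=1$ that extends from $A\cong A\otimes e_{11}$ to a quasitrace on $M_2(A)$. Each $\tau\in T(A)$ extends canonically to $(A\otimes\mathcal K)_+$ by $\tau(x)=\sum_i\tau(x_{ii})\in[0,\infty]$. For $a\in(A\otimes\mathcal K)_+$ put $d_\tau(a)=\lim_n\tau(f_n(a))\in[0,\infty]$, where $f_n$ vanishes on $[0,\tfrac1n]$, equals $1$ on $[\tfrac2n,\infty)$ and is linear in between. For positive $a,b$ in a $C^*$-algebra $B$, write $a\precsim b$ if there are $r_n\in B$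 with $\|r_nbr_n^*-a\|\to0$, and for $\varepsilon>0$ let $(a-\varepsilon)_+$ be the function $t\mapsto\max\{t-\varepsilon,0\}$ applied to $a$. * $A$ has *strict comparison* (with respect to traces) if $a\precsim b$ whenever $a,b\in(A\otimes\mathcal K)_+$, $b\ne0$ and $d_\tau(a)<d_\tau(b)$ for all $\tau\in T(A)$. * *All ranks are realized* if for every lower semicontinuous affine function $f\colon T(A)\to(0,\infty]$ there is $a\in(A\otimes\mathcal K)_+$ with $d_\tau(a)=f(\tau)$ for all $\tau\in T(A)$. Let $G$ be a discrete group and let $\alpha\colon G\to\mathrm{Aut}(A)$ be an action. Write $\alpha_g$ also for $\alpha_g\otimes\mathrm{id}_{\mathcal K}$, and $T(A)^\alpha$ for the set of $\alpha$-invariant traces in $T(A)$. For $a,b\in(A\otimes\mathcal K)_+$ write $a\precsim_0b$ if for every $\varepsilon>0$ there are $\delta>0$, $n\in\mathbb N$, $g_1,\dots,g_n\in G$ and $x_1,\dots,x_n\in(A\otimes\mathcal K)_+$ with $$(a-\varepsilon)_+\precsim\bigoplus_{j=1}^n\alpha_{g_j}(x_j)\quad\text{and}\quad\bigoplus_{j=1}^nx_j\precsim(b-\delta)_+,$$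 direct sums being formed in orthogonal copies of $A\otimes\mathcal K$ inside $A\otimes\mathcal K$. Write $a\precsim_\alpha b$ ($a$ is *dynamically subequivalent* to $b$) if there are $m\ge1$ and $y_1,\dots,y_m\in(A\otimes\mathcal K)_+$ with $a=y_1\precsim_0y_2\precsim_0\cdots\precsim_0y_m=b$. **Theorem.** Let $G$ be a countable, discrete, amenable group. Let $A$ be a simple, separable, unital $C^*$-algebra with strict comparison, such that $QT(A)=T(A)$ and such that all ranks are realized. Then every action $\alpha\colon G\to\mathrm{Aut}(A)$ has weak dynamical comparison: for all $a,b\in(A\otimes\mathcal K)_+$ with $b\ne0$, $$\sup_{\tau\in T(A)^\alpha}d_\tau(a)<\inf_{\tau\in T(A)^\alpha}d_\tau(b)\quad\Longrightarrow\quad a\precsim_\alpha b,$$ where supremum and infimum are taken in $[0,\infty]$. -/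

import Mathlib

open Filter Topology
open scoped ENNReal ComplexOrder

set_option linter.unusedSectionVars false

noncomputable section

namespace DynComp

universe u v

section FiniteMatrices

variable (A : Type u) [CStarAlgebra A]

/-- Infinite matrices over `A`, indexed by `ℕ × ℕ`, with only finitely many nonzero entries,
as a subspace of all infinite matrices. -/
def finMatSubmodule : Submodule ℂ (Matrix ℕ ℕ A) where
  carrier := {x | ∃ n, ∀ i j, n ≤ i ∨ n ≤ j → x i j = 0}
  zero_mem' := ⟨0, fun _ _ _ => rfl⟩
  add_mem' := by
    rintro x y ⟨n, hn⟩ ⟨m, hm⟩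
    refine ⟨max n m, fun i j h => ?_⟩
    rw [Matrix.add_apply, hn i j (by omega), hm i j (by omega), add_zero]
  smul_mem' := by
    rintro c x ⟨n, hn⟩
    exact ⟨n, fun i j h => by rw [Matrix.smul_apply, hn i j h, smul_zero]⟩

/-- The `*`-algebra `M_∞(A) = ⋃ₙ Mₙ(A)` of infinite matrices over `A` with finitely many
nonzero entries. -/
def FinMat : Type u := ↥(finMatSubmodule A)

instance : AddCommGroup (FinMat A) := inferInstanceAs (AddCommGroup ↥(finMatSubmodule A))
instance : Module ℂ (FinMat A) := inferInstanceAs (Module ℂ ↥(finMatSubmodule A))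

namespace FinMat

variable {A}

/-- The `(i, j)` entry of a finitely supported matrix. -/
def entry (x : FinMat A) (i j : ℕ) : A := x.1 i j

/-- `x` lives in the upper left `n × n` corner. -/
def SuppIn (x : FinMat A) (n : ℕ) : Prop := ∀ i j, n ≤ i ∨ n ≤ j → x.entry i j = 0

/-- Build a finitely supported matrix from its entries. -/
def mk (f : ℕ → ℕ → A) (h : ∃ n, ∀ i j, n ≤ i ∨ n ≤ j → f i j = 0) : FinMat A := ⟨f, h⟩

@[simp] lemma entry_mk (f : ℕ → ℕ → A) (h) (i j : ℕ) : (mk f h).entry i j = f i j := rfl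

lemma exists_suppIn (x : FinMat A) : ∃ n, x.SuppIn n := x.2

lemma SuppIn.mono {x : FinMat A} {n m : ℕ} (h : x.SuppIn n) (hnm : n ≤ m) : x.SuppIn m :=
  fun i j hij => h i j (by omega)

@[ext] lemma ext {x y : FinMat A} (h : ∀ i j, x.entry i j = y.entry i j) : x = y :=
  Subtype.ext (funext fun i => funext fun j => h i j)

@[simp] lemma entry_zero (i j : ℕ) : (0 : FinMat A).entry i j = 0 := rfl
@[simp] lemma entry_add (x y : FinMat A) (i j : ℕ) :
    (x + y).entry i j = x.entry i j + y.entry i j := rfl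
@[simp] lemma entry_neg (x : FinMat A) (i j : ℕ) : (-x).entry i j = -x.entry i j := rfl
@[simp] lemma entry_smul (c : ℂ) (x : FinMat A) (i j : ℕ) :
    (c • x).entry i j = c • x.entry i j := rfl

/-- Matrix multiplication; the sum has finitely many nonzero terms. -/
instance : Mul (FinMat A) where
  mul x y := mk (fun i j => ∑ᶠ k, x.entry i k * y.entry k j) (by
    obtain ⟨n, hn⟩ := x.exists_suppIn
    obtain ⟨m, hm⟩ := y.exists_suppIn
    refine ⟨max n m, fun i j h => ?_⟩
    rw [← finsum_zero (α := ℕ)]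
    refine finsum_congr fun k => ?_
    rcases h with h | h
    · rw [hn i k (by omega), zero_mul]
    · rw [hm k j (by omega), mul_zero])

lemma entry_mul (x y : FinMat A) (i j : ℕ) :
    (x * y).entry i j = ∑ᶠ k, x.entry i k * y.entry k j := rfl

lemma entry_mul_eq_sum {x : FinMat A} {n : ℕ} (hx : x.SuppIn n) (y : FinMat A) (i j : ℕ) :
    (x * y).entry i j = ∑ k : Fin n, x.entry i k * y.entry k j := by
  rw [entry_mul, Fin.sum_univ_eq_sum_range (fun k => x.entry i k * y.entry k j) n]
  refine finsum_eq_sum_of_support_subset _ fun k hk => ?_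
  by_contra h
  refine hk ?_
  simp only [Finset.coe_range, Set.mem_Iio, not_lt] at h
  change x.entry i k * y.entry k j = 0
  rw [hx i k (Or.inr h), zero_mul]

lemma SuppIn.mul {x y : FinMat A} {n : ℕ} (hx : x.SuppIn n) (hy : y.SuppIn n) :
    (x * y).SuppIn n := by
  intro i j h
  rw [entry_mul_eq_sum hx]
  refine Finset.sum_eq_zero fun k _ => ?_
  rcases h with h | h
  · rw [hx i k (Or.inl h), zero_mul]
  · rw [hy k j (Or.inr h), mul_zero]

lemma SuppIn.add {x y : FinMat A} {n : ℕ} (hx : x.SuppIn n) (hy : y.SuppIn n) :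
    (x + y).SuppIn n := fun i j h => by rw [entry_add, hx i j h, hy i j h, add_zero]

lemma SuppIn.smul {x : FinMat A} {n : ℕ} (c : ℂ) (hx : x.SuppIn n) :
    (c • x).SuppIn n := fun i j h => by rw [entry_smul, hx i j h, smul_zero]

/-- Conjugate transpose. -/
instance : Star (FinMat A) where
  star x := mk (fun i j => star (x.entry j i)) (by
    obtain ⟨n, hn⟩ := x.exists_suppIn
    exact ⟨n, fun i j h => by rw [hn j i h.symm, star_zero]⟩)

@[simp] lemma entry_star (x : FinMat A) (i j : ℕ) : (star x).entry i j = star (x.entry j i) := rfl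

lemma SuppIn.star {x : FinMat A} {n : ℕ} (hx : x.SuppIn n) : (star x).SuppIn n :=
  fun i j h => by rw [entry_star, hx j i h.symm, star_zero]

/-- The upper left `n × n` corner of `x`. -/
def trunc (n : ℕ) (x : FinMat A) : CStarMatrix (Fin n) (Fin n) A :=
  CStarMatrix.ofMatrix fun i j => x.entry i j

@[simp] lemma trunc_apply (n : ℕ) (x : FinMat A) (i j : Fin n) :
    trunc n x i j = x.entry i j := rfl

lemma eq_of_trunc_eq {x y : FinMat A} {n : ℕ} (hx : x.SuppIn n) (hy : y.SuppIn n)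
    (h : trunc n x = trunc n y) : x = y := by
  ext i j
  by_cases hij : n ≤ i ∨ n ≤ j
  · rw [hx i j hij, hy i j hij]
  · push Not at hij
    exact CStarMatrix.ext_iff.2 h ⟨i, hij.1⟩ ⟨j, hij.2⟩

@[simp] lemma trunc_zero (n : ℕ) : trunc n (0 : FinMat A) = 0 := rfl
@[simp] lemma trunc_add (n : ℕ) (x y : FinMat A) : trunc n (x + y) = trunc n x + trunc n y := rfl
@[simp] lemma trunc_smul (n : ℕ) (c : ℂ) (x : FinMat A) : trunc n (c • x) = c • trunc n x := rfl
@[simp] lemma trunc_star (n : ℕ) (x : FinMat A) : trunc n (star x) = star (trunc n x) := by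
  ext i j
  simp [CStarMatrix.star_apply]

lemma trunc_mul {n : ℕ} {x : FinMat A} (hx : x.SuppIn n) (y : FinMat A) :
    trunc n (x * y) = trunc n x * trunc n y := by
  ext i j
  rw [CStarMatrix.mul_apply, trunc_apply, entry_mul_eq_sum hx]
  rfl

lemma exists_suppIn₃ (x y z : FinMat A) : ∃ n, x.SuppIn n ∧ y.SuppIn n ∧ z.SuppIn n := by
  obtain ⟨n, hn⟩ := x.exists_suppIn
  obtain ⟨m, hm⟩ := y.exists_suppIn
  obtain ⟨k, hk⟩ := z.exists_suppIn
  exact ⟨max n (max m k), hn.mono (by omega), hm.mono (by omega), hk.mono (by omega)⟩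

instance : NonUnitalRing (FinMat A) where
  left_distrib x y z := by
    obtain ⟨n, hx, hy, hz⟩ := exists_suppIn₃ x y z
    refine eq_of_trunc_eq (hx.mul (hy.add hz)) ((hx.mul hy).add (hx.mul hz)) ?_
    rw [trunc_mul hx, trunc_add, trunc_add, trunc_mul hx, trunc_mul hx, mul_add]
  right_distrib x y z := by
    obtain ⟨n, hx, hy, hz⟩ := exists_suppIn₃ x y z
    refine eq_of_trunc_eq ((hx.add hy).mul hz) ((hx.mul hz).add (hy.mul hz)) ?_
    rw [trunc_mul (hx.add hy), trunc_add, trunc_add, trunc_mul hx, trunc_mul hy, add_mul]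
  zero_mul x := by
    obtain ⟨n, hx, hy, -⟩ := exists_suppIn₃ x 0 0
    refine eq_of_trunc_eq (hy.mul hx) hy ?_
    rw [trunc_mul hy, trunc_zero, zero_mul]
  mul_zero x := by
    obtain ⟨n, hx, hy, -⟩ := exists_suppIn₃ x 0 0
    refine eq_of_trunc_eq (hx.mul hy) hy ?_
    rw [trunc_mul hx, trunc_zero, mul_zero]
  mul_assoc x y z := by
    obtain ⟨n, hx, hy, hz⟩ := exists_suppIn₃ x y z
    refine eq_of_trunc_eq ((hx.mul hy).mul hz) (hx.mul (hy.mul hz)) ?_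
    rw [trunc_mul (hx.mul hy), trunc_mul hx, trunc_mul hx, trunc_mul hy, mul_assoc]

instance : StarRing (FinMat A) where
  star_involutive x := by ext; simp
  star_mul x y := by
    obtain ⟨n, hx, hy, -⟩ := exists_suppIn₃ x y 0
    refine eq_of_trunc_eq (hx.mul hy).star (hy.star.mul hx.star) ?_
    rw [trunc_star, trunc_mul hx, trunc_mul hy.star, trunc_star, trunc_star, star_mul]
  star_add x y := by ext; simp

instance : StarModule ℂ (FinMat A) where
  star_smul c x := by ext; simp

instance : IsScalarTower ℂ (FinMat A) (FinMat A) where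
  smul_assoc c x y := by
    obtain ⟨n, hx, hy, -⟩ := exists_suppIn₃ x y 0
    refine eq_of_trunc_eq ((hx.smul c).mul hy) ((hx.mul hy).smul c) ?_
    simp only [smul_eq_mul]
    rw [trunc_mul (hx.smul c), trunc_smul, trunc_smul, trunc_mul hx, smul_mul_assoc]

instance : SMulCommClass ℂ (FinMat A) (FinMat A) where
  smul_comm c x y := by
    obtain ⟨n, hx, hy, -⟩ := exists_suppIn₃ x y 0
    refine eq_of_trunc_eq ((hx.mul hy).smul c) (hx.mul (hy.smul c)) ?_
    simp only [smul_eq_mul]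
    rw [trunc_mul hx, trunc_smul, trunc_smul, trunc_mul hx, mul_smul_comm]

/-- Placing an `m × m` matrix in the block of a `k × k` matrix given by an injection of the
index sets. -/
def pad {ι κ : Type} [Fintype ι] [Fintype κ] [DecidableEq κ] (f : ι ↪ κ) :
    CStarMatrix ι ι A →⋆ₙₐ[ℂ] CStarMatrix κ κ A :=
  let V : Matrix κ ι A := Matrix.of fun k i => if f i = k then 1 else 0
  have hV : ∀ N : Matrix ι κ A, V.conjTranspose * (V * N) = N := by
    classical
    intro N
    rw [← Matrix.mul_assoc]
    suffices h : V.conjTranspose * V = 1 by rw [h, Matrix.one_mul]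
    ext i j
    simp only [V, Matrix.mul_apply, Matrix.conjTranspose_apply, Matrix.of_apply, Matrix.one_apply]
    rw [Finset.sum_eq_single (f i)]
    · by_cases h : i = j
      · simp [h]
      · simp [h, Ne.symm h]
    · intro k _ hk
      simp [Ne.symm hk]
    · simp
  { toFun := fun M => CStarMatrix.ofMatrix (V * CStarMatrix.ofMatrix.symm M * V.conjTranspose)
    map_smul' := fun c M => by
      change V * (c • (CStarMatrix.ofMatrix.symm M)) * V.conjTranspose
        = c • (V * CStarMatrix.ofMatrix.symm M * V.conjTranspose)
      rw [Matrix.mul_smul, Matrix.smul_mul]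
    map_zero' := by
      change V * (0 : Matrix ι ι A) * V.conjTranspose = 0
      simp
    map_add' := fun M N => by
      change V * (CStarMatrix.ofMatrix.symm M + CStarMatrix.ofMatrix.symm N) * V.conjTranspose = _
      rw [Matrix.mul_add, Matrix.add_mul]
      rfl
    map_mul' := fun M N => by
      classical
      change V * (CStarMatrix.ofMatrix.symm M * CStarMatrix.ofMatrix.symm N) * V.conjTranspose
        = (V * CStarMatrix.ofMatrix.symm M * V.conjTranspose) *
          (V * CStarMatrix.ofMatrix.symm N * V.conjTranspose)
      simp only [Matrix.mul_assoc, hV]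
    map_star' := fun M => by
      change V * (CStarMatrix.ofMatrix.symm M).conjTranspose * V.conjTranspose
        = (V * CStarMatrix.ofMatrix.symm M * V.conjTranspose).conjTranspose
      rw [Matrix.conjTranspose_mul, Matrix.conjTranspose_mul, Matrix.conjTranspose_conjTranspose,
        Matrix.mul_assoc] }

lemma pad_apply {ι κ : Type} [Fintype ι] [Fintype κ] [DecidableEq κ] (f : ι ↪ κ)
    (M : CStarMatrix ι ι A) (k l : κ) :
    pad f M k l = ∑ j, ∑ i, if f i = k ∧ f j = l then M i j else 0 := by
  change ((Matrix.of fun k i => if f i = k then (1 : A) else 0) * CStarMatrix.ofMatrix.symm M *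
    (Matrix.of fun k i => if f i = k then (1 : A) else 0).conjTranspose) k l = _
  rw [Matrix.mul_apply]
  refine Finset.sum_congr rfl fun j _ => ?_
  rw [Matrix.mul_apply, Finset.sum_mul]
  refine Finset.sum_congr rfl fun i _ => ?_
  by_cases h₁ : f i = k <;> by_cases h₂ : f j = l <;> simp [h₁, h₂]

lemma pad_apply_embed {ι κ : Type} [Fintype ι] [Fintype κ] [DecidableEq κ] (f : ι ↪ κ)
    (M : CStarMatrix ι ι A) (i j : ι) : pad f M (f i) (f j) = M i j := by
  classical
  rw [pad_apply, Finset.sum_eq_single j, Finset.sum_eq_single i]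
  · simp
  · intro i' _ h
    simp [h]
  · simp
  · intro j' _ h
    refine Finset.sum_eq_zero fun i' _ => ?_
    simp [h]
  · simp

lemma pad_apply_of_notMem {ι κ : Type} [Fintype ι] [Fintype κ] [DecidableEq κ] (f : ι ↪ κ)
    (M : CStarMatrix ι ι A) (k l : κ) (h : (∀ i, f i ≠ k) ∨ ∀ j, f j ≠ l) :
    pad f M k l = 0 := by
  rw [pad_apply]
  refine Finset.sum_eq_zero fun j _ => Finset.sum_eq_zero fun i _ => ?_
  rw [if_neg]
  rintro ⟨h₁, h₂⟩
  rcases h with h | h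
  · exact h i h₁
  · exact h j h₂

variable [PartialOrder A] [StarOrderedRing A]

lemma norm_pad {ι κ : Type} [Fintype ι] [Fintype κ] [DecidableEq κ] (f : ι ↪ κ)
    (M : CStarMatrix ι ι A) : ‖pad f M‖ = ‖M‖ :=
  NonUnitalStarAlgHom.norm_map (pad f) (fun M N h => by
    ext i j
    rw [← pad_apply_embed f M, h, pad_apply_embed]) M

lemma trunc_eq_pad {x : FinMat A} {n m : ℕ} (hx : x.SuppIn n) (hnm : n ≤ m) :
    trunc m x = pad (Fin.castLEEmb hnm) (trunc n x) := by
  ext k l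
  by_cases h : n ≤ (k : ℕ) ∨ n ≤ (l : ℕ)
  · rw [trunc_apply, hx k l h, pad_apply_of_notMem]
    rcases h with h | h
    · left
      intro i hi
      have := congrArg Fin.val hi
      simp at this
      omega
    · right
      intro i hi
      have := congrArg Fin.val hi
      simp at this
      omega
  · push Not at h
    have hk : k = Fin.castLEEmb hnm ⟨k, h.1⟩ := by ext; simp
    have hl : l = Fin.castLEEmb hnm ⟨l, h.2⟩ := by ext; simp
    have e := pad_apply_embed (Fin.castLEEmb hnm) (trunc n x) ⟨k, h.1⟩ ⟨l, h.2⟩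
    rw [← hk, ← hl] at e
    rw [e]
    rfl

/-- The norm of `x` is the C*-norm of any upper left corner `Mₙ(A)` containing `x`. -/
instance : Norm (FinMat A) where
  norm x := ‖trunc (Classical.choose x.exists_suppIn) x‖

lemma norm_eq {x : FinMat A} {n : ℕ} (hx : x.SuppIn n) : ‖x‖ = ‖trunc n x‖ := by
  change ‖trunc (Classical.choose x.exists_suppIn) x‖ = _
  have hs := Classical.choose_spec x.exists_suppIn
  rcases le_total n (Classical.choose x.exists_suppIn) with h | h
  · rw [trunc_eq_pad hx h, norm_pad]
  · rw [trunc_eq_pad hs h, norm_pad]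

lemma normCore : NormedSpace.Core ℂ (FinMat A) where
  norm_nonneg x := norm_nonneg (trunc _ x)
  norm_smul c x := by
    obtain ⟨n, hx⟩ := x.exists_suppIn
    rw [norm_eq (hx.smul c), norm_eq hx, trunc_smul, norm_smul]
  norm_triangle x y := by
    obtain ⟨n, hx, hy, -⟩ := exists_suppIn₃ x y 0
    rw [norm_eq (hx.add hy), norm_eq hx, norm_eq hy, trunc_add]
    exact norm_add_le _ _
  norm_eq_zero_iff x := by
    obtain ⟨n, hx, h0, -⟩ := exists_suppIn₃ x 0 0
    rw [norm_eq hx, norm_eq_zero, ← trunc_zero n]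
    exact ⟨fun h => eq_of_trunc_eq hx h0 h, fun h => by rw [h]⟩

instance : NormedAddCommGroup (FinMat A) := .ofCore normCore

instance : NormedSpace ℂ (FinMat A) := .ofCore normCore

instance : NonUnitalNormedRing (FinMat A) where
  __ : NonUnitalRing (FinMat A) := inferInstance
  __ : NormedAddCommGroup (FinMat A) := inferInstance
  norm_mul_le x y := by
    obtain ⟨n, hx, hy, -⟩ := exists_suppIn₃ x y 0
    rw [norm_eq (hx.mul hy), norm_eq hx, norm_eq hy, trunc_mul hx]
    exact norm_mul_le _ _

instance : CStarRing (FinMat A) :=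
  .of_le_norm_mul_star_self fun x => by
    obtain ⟨n, hx⟩ := x.exists_suppIn
    rw [norm_eq hx, norm_eq (hx.mul hx.star), trunc_mul hx, trunc_star,
      CStarRing.norm_self_mul_star]

lemma norm_entry_le (x : FinMat A) (i j : ℕ) : ‖x.entry i j‖ ≤ ‖x‖ := by
  obtain ⟨n, hx⟩ := x.exists_suppIn
  have h := hx.mono (le_max_left n (max (i + 1) (j + 1)))
  rw [norm_eq h]
  exact CStarMatrix.norm_entry_le_norm (M := trunc _ x)
    (i := ⟨i, by omega⟩) (j := ⟨j, by omega⟩)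

/-- Entrywise application of a `*`-homomorphism. -/
def map (φ : A →⋆ₙₐ[ℂ] A) : FinMat A →⋆ₙₐ[ℂ] FinMat A where
  toFun x := mk (fun i j => φ (x.entry i j)) (by
    obtain ⟨n, hn⟩ := x.exists_suppIn
    exact ⟨n, fun i j h => by rw [hn i j h, map_zero]⟩)
  map_smul' c x := by ext; simp
  map_zero' := by ext; simp
  map_add' x y := by ext; simp
  map_mul' x y := by
    obtain ⟨n, hn⟩ := x.exists_suppIn
    have hn' : (mk (fun i j => φ (x.entry i j))
        ⟨n, fun i j h => by rw [hn i j h, map_zero]⟩ : FinMat A).SuppIn n :=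
      fun i j h => by rw [entry_mk, hn i j h, map_zero]
    ext i j
    rw [entry_mul_eq_sum hn', entry_mk, entry_mul_eq_sum hn, map_sum]
    simp
  map_star' x := by ext; simp [map_star]

@[simp] lemma entry_map (φ : A →⋆ₙₐ[ℂ] A) (x : FinMat A) (i j : ℕ) :
    (map φ x).entry i j = φ (x.entry i j) := rfl

lemma norm_map_le (φ : A →⋆ₙₐ[ℂ] A) (x : FinMat A) : ‖map φ x‖ ≤ ‖x‖ := by
  obtain ⟨n, hn⟩ := x.exists_suppIn
  have hn' : (map φ x).SuppIn n := fun i j h => by rw [entry_map, hn i j h, map_zero]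
  rw [norm_eq hn, norm_eq hn']
  exact NonUnitalStarAlgHom.norm_apply_le (CStarMatrix.mapₙₐ φ) (trunc n x)

/-- The underlying function of `shift`. -/
def shiftFun (r : ℕ) (x : FinMat A) : FinMat A :=
  mk (fun p q => if p.unpair.1 = r ∧ q.unpair.1 = r then
      x.entry p.unpair.2 q.unpair.2 else 0) (by
    obtain ⟨n, hn⟩ := x.exists_suppIn
    refine ⟨Nat.pair r n, fun p q h => ?_⟩
    split_ifs with hr
    · refine hn _ _ ?_
      by_contra! hc
      have h₁ := Nat.pair_lt_pair_right r hc.1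
      have h₂ := Nat.pair_lt_pair_right r hc.2
      have e₁ : Nat.pair r p.unpair.2 = p := by rw [← hr.1, Nat.pair_unpair]
      have e₂ : Nat.pair r q.unpair.2 = q := by rw [← hr.2, Nat.pair_unpair]
      omega
    · rfl)

lemma entry_shiftFun (r : ℕ) (x : FinMat A) (p q : ℕ) :
    (shiftFun r x).entry p q = if p.unpair.1 = r ∧ q.unpair.1 = r then
      x.entry p.unpair.2 q.unpair.2 else 0 := rfl

lemma SuppIn.shiftFun {x : FinMat A} {n : ℕ} (hn : x.SuppIn n) (r : ℕ) :
    (shiftFun r x).SuppIn (Nat.pair r n) := by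
  intro p q h
  rw [entry_shiftFun]
  split_ifs with hr
  · refine hn _ _ ?_
    by_contra! hc
    have h₁ := Nat.pair_lt_pair_right r hc.1
    have h₂ := Nat.pair_lt_pair_right r hc.2
    have e₁ : Nat.pair r p.unpair.2 = p := by rw [← hr.1, Nat.pair_unpair]
    have e₂ : Nat.pair r q.unpair.2 = q := by rw [← hr.2, Nat.pair_unpair]
    omega
  · rfl

/-- The injection `k ↦ Nat.pair r k` on initial segments. -/
def pairEmb (r n : ℕ) : Fin n ↪ Fin (Nat.pair r n) where
  toFun i := ⟨Nat.pair r i, Nat.pair_lt_pair_right r i.2⟩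
  inj' i j h := by
    have := congrArg Fin.val h
    simpa [Nat.pair_eq_pair, Fin.ext_iff] using this

@[simp] lemma coe_pairEmb (r n : ℕ) (i : Fin n) : (pairEmb r n i : ℕ) = Nat.pair r i := rfl

lemma trunc_shiftFun {x : FinMat A} {n : ℕ} (hn : x.SuppIn n) (r : ℕ) :
    trunc (Nat.pair r n) (shiftFun r x) = pad (pairEmb r n) (trunc n x) := by
  ext k l
  rw [trunc_apply, entry_shiftFun]
  by_cases hk : ∃ i, pairEmb r n i = k
  · by_cases hl : ∃ j, pairEmb r n j = l
    · obtain ⟨i, rfl⟩ := hk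
      obtain ⟨j, rfl⟩ := hl
      rw [pad_apply_embed]
      simp
    · push Not at hl
      rw [pad_apply_of_notMem _ _ _ _ (Or.inr hl)]
      split_ifs with hr
      · refine hn _ _ (Or.inr ?_)
        by_contra! hc
        refine hl ⟨_, hc⟩ ?_
        ext
        simpa only [coe_pairEmb, hr.2] using Nat.pair_unpair (l : ℕ)
      · rfl
  · push Not at hk
    rw [pad_apply_of_notMem _ _ _ _ (Or.inl hk)]
    split_ifs with hr
    · refine hn _ _ (Or.inl ?_)
      by_contra! hc
      refine hk ⟨_, hc⟩ ?_
      ext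
      simpa only [coe_pairEmb, hr.1] using Nat.pair_unpair (k : ℕ)
    · rfl

/-- The `r`-th copy of `M_∞(A)` inside `M_∞(A)`: the row and column index `k` is moved to
`Nat.pair r k`. The copies for different `r` are orthogonal. -/
def shift (r : ℕ) : FinMat A →⋆ₙₐ[ℂ] FinMat A where
  toFun x := shiftFun r x
  map_smul' c x := by ext i j; simp [entry_shiftFun]
  map_zero' := by ext; simp [entry_shiftFun]
  map_add' x y := by
    ext i j
    simp only [entry_shiftFun, entry_add]
    split_ifs <;> simp
  map_mul' x y := by
    obtain ⟨n, hx, hy, -⟩ := exists_suppIn₃ x y 0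
    refine eq_of_trunc_eq ((hx.mul hy).shiftFun r) ((hx.shiftFun r).mul (hy.shiftFun r)) ?_
    rw [trunc_mul (hx.shiftFun r), trunc_shiftFun (hx.mul hy), trunc_shiftFun hx,
      trunc_shiftFun hy, trunc_mul hx, map_mul]
  map_star' x := by
    ext i j
    simp only [entry_shiftFun, entry_star, and_comm]
    split_ifs <;> simp

lemma norm_shift_le (r : ℕ) (x : FinMat A) : ‖shift r x‖ ≤ ‖x‖ := by
  obtain ⟨n, hn⟩ := x.exists_suppIn
  change ‖shiftFun r x‖ ≤ _
  rw [norm_eq hn, norm_eq (hn.shiftFun r), trunc_shiftFun hn, norm_pad]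

end FinMat

end FiniteMatrices

section Stabilization

variable (A : Type u) [CStarAlgebra A] [PartialOrder A] [StarOrderedRing A]

/-- The stabilization `A ⊗ 𝓚`, where `𝓚` is the algebra of compact operators on `ℓ²(ℕ)`:
the completion of `M_∞(A)` in its C*-norm. -/
def Stabilization : Type u := UniformSpace.Completion (FinMat A)

instance : NormedAddCommGroup (Stabilization A) :=
  inferInstanceAs (NormedAddCommGroup (UniformSpace.Completion (FinMat A)))
instance : NormedSpace ℂ (Stabilization A) :=
  inferInstanceAs (NormedSpace ℂ (UniformSpace.Completion (FinMat A)))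
instance : CompleteSpace (Stabilization A) :=
  inferInstanceAs (CompleteSpace (UniformSpace.Completion (FinMat A)))

namespace Stabilization

variable {A}

open UniformSpace

/-- The inclusion of `M_∞(A)` into `A ⊗ 𝓚`. -/
def of : FinMat A →L[ℂ] Stabilization A := Completion.toComplL

@[simp] lemma norm_of (x : FinMat A) : ‖of x‖ = ‖x‖ := Completion.norm_coe x

lemma isDenseInducing_of : IsDenseInducing (of : FinMat A → Stabilization A) :=
  Completion.isDenseInducing_coe

@[elab_as_elim] lemma induction_on {p : Stabilization A → Prop} (x : Stabilization A)
    (hp : IsClosed {x | p x}) (h : ∀ a, p (of a)) : p x :=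
  Completion.induction_on x hp h

@[elab_as_elim] lemma induction_on₂ {p : Stabilization A → Stabilization A → Prop} (x y : Stabilization A)
    (hp : IsClosed {z : Stabilization A × Stabilization A | p z.1 z.2})
    (h : ∀ a b, p (of a) (of b)) : p x y :=
  Completion.induction_on₂ x y hp h

@[elab_as_elim] lemma induction_on₃ {p : Stabilization A → Stabilization A → Stabilization A → Prop}
    (x y z : Stabilization A)
    (hp : IsClosed {w : Stabilization A × Stabilization A × Stabilization A |
      p w.1 w.2.1 w.2.2})
    (h : ∀ a b c, p (of a) (of b) (of c)) : p x y z :=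
  Completion.induction_on₃ x y z hp h

/-- Multiplication, extended by continuity. -/
instance : Mul (Stabilization A) where
  mul := Function.curry <|
    (isDenseInducing_of.prodMap isDenseInducing_of).extend (of ∘ Function.uncurry (· * ·))

lemma of_mul (x y : FinMat A) : of (x * y) = of x * of y :=
  ((isDenseInducing_of.prodMap isDenseInducing_of).extend_eq
    (of.continuous.comp (@continuous_mul (FinMat A) _ _ _)) (x, y)).symm

instance : ContinuousMul (Stabilization A) where
  continuous_mul := by
    let m := (AddMonoidHom.mul : FinMat A →+ FinMat A →+ FinMat A).compr₂
      (of : FinMat A →L[ℂ] Stabilization A).toLinearMap.toAddMonoidHom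
    have : Continuous fun p : FinMat A × FinMat A => m p.1 p.2 :=
      of.continuous.comp continuous_mul
    have di : IsDenseInducing
      ((of : FinMat A →L[ℂ] Stabilization A).toLinearMap.toAddMonoidHom) := isDenseInducing_of
    exact (di.extend_Z_bilin di this :)

/-- The involution, extended by continuity. -/
instance : Star (Stabilization A) where
  star := Completion.map (star : FinMat A → FinMat A)

lemma uniformContinuous_star_finMat : UniformContinuous (star : FinMat A → FinMat A) :=
  (starₗᵢ ℂ : FinMat A ≃ₗᵢ⋆[ℂ] FinMat A).isometry.uniformContinuous

lemma of_star (x : FinMat A) : of (star x) = star (of x) :=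
  (Completion.map_coe uniformContinuous_star_finMat x).symm

instance : ContinuousStar (Stabilization A) where
  continuous_star := Completion.continuous_map

instance : NonUnitalRing (Stabilization A) where
  left_distrib x y z := induction_on₃ x y z
    (isClosed_eq (by fun_prop) (by fun_prop))
    fun a b c => by simp only [← of_mul, ← map_add, mul_add]
  right_distrib x y z := induction_on₃ x y z
    (isClosed_eq (by fun_prop) (by fun_prop))
    fun a b c => by simp only [← of_mul, ← map_add, add_mul]
  zero_mul x := induction_on x (isClosed_eq (by fun_prop) (by fun_prop))
    fun a => by rw [← map_zero (of : FinMat A →L[ℂ] Stabilization A), ← of_mul, zero_mul]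
  mul_zero x := induction_on x (isClosed_eq (by fun_prop) (by fun_prop))
    fun a => by rw [← map_zero (of : FinMat A →L[ℂ] Stabilization A), ← of_mul, mul_zero]
  mul_assoc x y z := induction_on₃ x y z
    (isClosed_eq (by fun_prop) (by fun_prop))
    fun a b c => by simp only [← of_mul, mul_assoc]

instance : NonUnitalNormedRing (Stabilization A) where
  __ : NonUnitalRing (Stabilization A) := inferInstance
  __ : NormedAddCommGroup (Stabilization A) := inferInstance
  norm_mul_le x y := induction_on₂ x y (isClosed_le (by fun_prop) (by fun_prop))
    fun a b => by
      rw [← of_mul, norm_of, norm_of, norm_of]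
      exact norm_mul_le a b

instance : StarRing (Stabilization A) where
  star_involutive x := induction_on x (isClosed_eq (by fun_prop) (by fun_prop))
    fun a => by rw [← of_star, ← of_star, star_star]
  star_mul x y := induction_on₂ x y (isClosed_eq (by fun_prop) (by fun_prop))
    fun a b => by simp only [← of_mul, ← of_star, star_mul]
  star_add x y := induction_on₂ x y (isClosed_eq (by fun_prop) (by fun_prop))
    fun a b => by simp only [← map_add, ← of_star, star_add]

instance : CStarRing (Stabilization A) where
  norm_mul_self_le x := induction_on x (isClosed_le (by fun_prop) (by fun_prop))
    fun a => by
      rw [← of_star, ← of_mul, norm_of, norm_of]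
      exact CStarRing.norm_mul_self_le a

instance : IsScalarTower ℂ (Stabilization A) (Stabilization A) where
  smul_assoc c x y := induction_on₂ x y
    (isClosed_eq ((continuous_fst.const_smul c).mul continuous_snd)
      ((continuous_fst.mul continuous_snd).const_smul c))
    fun a b => by
      rw [smul_eq_mul, smul_eq_mul, ← map_smul, ← of_mul, ← of_mul, ← map_smul, smul_mul_assoc]

instance : SMulCommClass ℂ (Stabilization A) (Stabilization A) where
  smul_comm c x y := induction_on₂ x y
    (isClosed_eq ((continuous_fst.mul continuous_snd).const_smul c)
      (continuous_fst.mul (continuous_snd.const_smul c)))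
    fun a b => by
      rw [smul_eq_mul, smul_eq_mul, ← map_smul, ← of_mul, ← of_mul, ← map_smul, mul_smul_comm]

instance : StarModule ℂ (Stabilization A) where
  star_smul c x := induction_on x
    (isClosed_eq (continuous_id.const_smul c).star (continuous_star.const_smul (star c)))
    fun a => by rw [← map_smul, ← of_star, ← of_star, ← map_smul, star_smul]

instance : NonUnitalCStarAlgebra (Stabilization A) where

/-- The usual order: `x ≤ y` if and only if `y - x` is positive. -/
instance : PartialOrder (Stabilization A) := CStarAlgebra.spectralOrder _
instance : StarOrderedRing (Stabilization A) := CStarAlgebra.spectralOrderedRing _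

/-- Extension by continuity of a map of `M_∞(A)`. -/
def extendFun (f : FinMat A → FinMat A) : Stabilization A → Stabilization A := Completion.map f

lemma continuous_extendFun (f : FinMat A → FinMat A) : Continuous (extendFun f) :=
  Completion.continuous_map

lemma extendFun_of {f : FinMat A → FinMat A} (hf : UniformContinuous f) (a : FinMat A) :
    extendFun f (of a) = of (f a) := Completion.map_coe hf a

/-- Extension to `A ⊗ 𝓚` of a contractive `*`-homomorphism of `M_∞(A)`. -/
def extendHom (f : FinMat A →⋆ₙₐ[ℂ] FinMat A) (hf : ∀ x, ‖f x‖ ≤ ‖x‖) :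
    Stabilization A →⋆ₙₐ[ℂ] Stabilization A :=
  have hu : UniformContinuous f :=
    (AddMonoidHomClass.lipschitz_of_bound f 1 (by simpa using hf)).uniformContinuous
  have hc := continuous_extendFun f
  have he := extendFun_of hu
  { toFun := extendFun f
    map_smul' := fun c x => by
      refine induction_on x
        (isClosed_eq (hc.comp (continuous_id.const_smul c)) (hc.const_smul c)) fun a => ?_
      rw [← map_smul, he, he, map_smul, map_smul]
      rfl
    map_zero' := by
      rw [← map_zero (of : FinMat A →L[ℂ] Stabilization A), he, map_zero]
    map_add' := fun x y => by
      refine induction_on₂ x y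
        (isClosed_eq (hc.comp (continuous_fst.add continuous_snd))
          ((hc.comp continuous_fst).add (hc.comp continuous_snd))) fun a b => ?_
      rw [← map_add, he, he, he, map_add, map_add]
    map_mul' := fun x y => by
      refine induction_on₂ x y
        (isClosed_eq (hc.comp (continuous_fst.mul continuous_snd))
          ((hc.comp continuous_fst).mul (hc.comp continuous_snd))) fun a b => ?_
      rw [← of_mul, he, he, he, map_mul, of_mul]
    map_star' := fun x => by
      refine induction_on x
        (isClosed_eq (hc.comp continuous_star) (continuous_star.comp hc)) fun a => ?_
      rw [← of_star, he, he, map_star, of_star] }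

lemma extendHom_of (f : FinMat A →⋆ₙₐ[ℂ] FinMat A) (hf : ∀ x, ‖f x‖ ≤ ‖x‖) (a : FinMat A) :
    extendHom f hf (of a) = of (f a) :=
  extendFun_of
    (AddMonoidHomClass.lipschitz_of_bound f 1 (by simpa using hf)).uniformContinuous a

/-- The `*`-homomorphism `φ ⊗ id` of `A ⊗ 𝓚`. -/
def map (φ : A →⋆ₙₐ[ℂ] A) : Stabilization A →⋆ₙₐ[ℂ] Stabilization A :=
  extendHom (FinMat.map φ) (FinMat.norm_map_le φ)

/-- The `r`-th copy of `A ⊗ 𝓚` inside `A ⊗ 𝓚`; different copies are orthogonal. -/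
def shift (r : ℕ) : Stabilization A →⋆ₙₐ[ℂ] Stabilization A :=
  extendHom (FinMat.shift r) (FinMat.norm_shift_le r)

lemma map_of (φ : A →⋆ₙₐ[ℂ] A) (x : FinMat A) : map φ (of x) = of (FinMat.map φ x) :=
  extendHom_of _ _ x

lemma shift_of (r : ℕ) (x : FinMat A) : shift r (of x) = of (FinMat.shift r x) :=
  extendHom_of _ _ x

/-- The direct sum `x₁ ⊕ ⋯ ⊕ xₙ` in `A ⊗ 𝓚`, formed in orthogonal copies of `A ⊗ 𝓚`. -/
def dirSum {n : ℕ} (x : Fin n → Stabilization A) : Stabilization A := ∑ j : Fin n, shift j (x j)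

/-- The `(i, j)` matrix entry of an element of `A ⊗ 𝓚`. -/
def entry (i j : ℕ) : Stabilization A →L[ℂ] A :=
  (LinearMap.mkContinuous
    { toFun := fun x : FinMat A => x.entry i j
      map_add' := fun _ _ => rfl
      map_smul' := fun _ _ => rfl } 1
    (fun x => by rw [one_mul]; exact x.norm_entry_le i j)).extend of

lemma entry_of (i j : ℕ) (x : FinMat A) : entry i j (of x) = x.entry i j := by
  rw [entry, ContinuousLinearMap.extend_eq]
  · rfl
  · exact isDenseInducing_of.dense
  · exact (Isometry.isUniformInducing (AddMonoidHomClass.isometry_of_norm _ norm_of))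

end Stabilization

end Stabilization

section Comparison

variable {B : Type u} [NonUnitalCStarAlgebra B]

/-- Cuntz subequivalence `a ≾ b`: there are `rₙ` with `rₙ b rₙ* → a`. -/
def CuntzLE (a b : B) : Prop :=
  ∃ r : ℕ → B, Tendsto (fun n => r n * b * star (r n)) atTop (𝓝 a)

/-- The cut-down `(a - δ)₊`, for self-adjoint `a` and `δ > 0`. -/
def cutDown (a : B) (δ : ℝ) : B := cfcₙ (fun x : ℝ => max (x - δ) 0) a

/-- The function that vanishes on `[0, 1/n]`, equals `1` on `[2/n, ∞)` and is linear on
`[1/n, 2/n]`. -/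
def rampFun (n : ℕ) (x : ℝ) : ℝ := min 1 (max 0 (n * x - 1))

/-- A quasitrace on a C*-algebra `B`: a function that is positive and tracial on elements
`x* x`, is determined by its values on self-adjoint elements, and is linear on commutative
C*-subalgebras. -/
structure IsQuasitrace (φ : B → ℂ) : Prop where
  nonneg : ∀ x, 0 ≤ φ (star x * x)
  tracial : ∀ x, φ (star x * x) = φ (x * star x)
  add_I_smul : ∀ a b, IsSelfAdjoint a → IsSelfAdjoint b →
    φ (a + Complex.I • b) = φ a + Complex.I * φ b
  linear_on_comm : ∀ S : NonUnitalStarSubalgebra ℂ B, IsClosed (S : Set B) →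
    (∀ x ∈ S, ∀ y ∈ S, x * y = y * x) →
    (∀ x ∈ S, ∀ y ∈ S, φ (x + y) = φ x + φ y) ∧ (∀ (c : ℂ), ∀ x ∈ S, φ (c • x) = c * φ x)

end Comparison

section Traces

variable (A : Type u) [CStarAlgebra A]

/-- A C*-algebra is simple if it is nonzero and has no nontrivial closed two-sided ideals. -/
def IsSimpleCStar : Prop :=
  Nontrivial A ∧ ∀ I : TwoSidedIdeal A, IsClosed (I : Set A) → I = ⊥ ∨ I = ⊤

/-- The set `T(A)` of tracial states of a unital C*-algebra, with the weak* topology. -/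
def traceSpace : Set (WeakDual ℂ A) :=
  {τ | τ 1 = 1 ∧ (∀ a, 0 ≤ τ (star a * a)) ∧ ∀ a b, τ (a * b) = τ (b * a)}

/-- The set `T(A)^α` of invariant tracial states. -/
def invTraceSpace {A : Type u} [CStarAlgebra A] {G : Type v} [Group G]
    (α : G →* (A ≃⋆ₐ[ℂ] A)) : Set (WeakDual ℂ A) :=
  {τ | τ ∈ traceSpace A ∧ ∀ g a, τ (α g a) = τ a}

variable [PartialOrder A] [StarOrderedRing A]

/-- The set `QT(A)` of normalized 2-quasitraces: the quasitraces `φ` on `A` with `φ 1 = 1` that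
extend to a quasitrace on `M₂(A)`, where `A` is the upper left corner. -/
def quasitraceSpace : Set (A → ℂ) :=
  {φ | IsQuasitrace φ ∧ φ 1 = 1 ∧ ∃ ψ : CStarMatrix (Fin 2) (Fin 2) A → ℂ,
    IsQuasitrace ψ ∧ ∀ a, ψ (CStarMatrix.ofMatrix !![a, 0; 0, 0]) = φ a}

/-- `QT(A) = T(A)`. -/
def QuasitracesAreTraces : Prop :=
  quasitraceSpace A = (fun τ : WeakDual ℂ A => (τ : A → ℂ)) '' traceSpace A

variable {A}

/-- The canonical extension of a trace `τ` on `A` to the positive elements of `A ⊗ 𝓚`,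
`τ(x) = ∑ᵢ τ(xᵢᵢ) ∈ [0, ∞]`. -/
def traceExt (τ : WeakDual ℂ A) (x : Stabilization A) : ℝ≥0∞ :=
  ∑' i, ENNReal.ofReal (τ (Stabilization.entry i i x)).re

/-- The dimension function `d_τ(a) = limₙ τ(fₙ(a))` on positive elements `a` of `A ⊗ 𝓚`. The
sequence is increasing, so that the limit is a supremum. -/
def dimFun (τ : WeakDual ℂ A) (a : Stabilization A) : ℝ≥0∞ :=
  ⨆ n : ℕ, traceExt τ (cfcₙ (rampFun n) a)

variable (A)

/-- Strict comparison, with respect to traces. -/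
def StrictComparison : Prop :=
  ∀ a b : Stabilization A, 0 ≤ a → 0 ≤ b → b ≠ 0 →
    (∀ τ ∈ traceSpace A, dimFun τ a < dimFun τ b) → CuntzLE a b

/-- All ranks are realized: every lower semicontinuous affine function `T(A) → (0, ∞]` is the rank
function of a positive element of `A ⊗ 𝓚`. (The values of `f` outside of `T(A)` do not matter.) -/
def AllRanksRealized : Prop :=
  ∀ f : WeakDual ℂ A → ℝ≥0∞, LowerSemicontinuousOn f (traceSpace A) →
    (∀ τ ∈ traceSpace A, 0 < f τ) →
    (∀ σ ∈ traceSpace A, ∀ τ ∈ traceSpace A, ∀ s t : ℝ, 0 ≤ s → 0 ≤ t → s + t = 1 →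
      f ((s : ℂ) • σ + (t : ℂ) • τ) = ENNReal.ofReal s * f σ + ENNReal.ofReal t * f τ) →
    ∃ a : Stabilization A, 0 ≤ a ∧ ∀ τ ∈ traceSpace A, dimFun τ a = f τ

end Traces

section Dynamics

open scoped Pointwise symmDiff

/-- A countable discrete group is amenable if it has a Følner sequence. -/
def IsAmenable (G : Type v) [Group G] : Prop :=
  ∃ F : ℕ → Set G, (∀ n, (F n).Finite ∧ (F n).Nonempty) ∧
    ∀ g : G, Tendsto (fun n => (((g • F n) ∆ F n).ncard : ℝ) / ((F n).ncard : ℝ)) atTop (𝓝 0)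

variable {A : Type u} [CStarAlgebra A] [PartialOrder A] [StarOrderedRing A]
  {G : Type v} [Group G]

/-- The induced action `α_g ⊗ id` on `A ⊗ 𝓚`. -/
def stabAct (α : G →* (A ≃⋆ₐ[ℂ] A)) (g : G) : Stabilization A →⋆ₙₐ[ℂ] Stabilization A :=
  Stabilization.map (α g : A →⋆ₙₐ[ℂ] A)

/-- `a` is elementarily dynamically subequivalent to `b`. -/
def ElemDynLE (α : G →* (A ≃⋆ₐ[ℂ] A)) (a b : Stabilization A) : Prop :=
  ∀ ε : ℝ, 0 < ε → ∃ δ : ℝ, 0 < δ ∧ ∃ (n : ℕ) (g : Fin n → G) (x : Fin n → Stabilization A),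
    (∀ j, 0 ≤ x j) ∧
    CuntzLE (cutDown a ε) (Stabilization.dirSum fun j => stabAct α (g j) (x j)) ∧
    CuntzLE (Stabilization.dirSum x) (cutDown b δ)

/-- `a` is dynamically subequivalent to `b`: there is a finite chain of elementary dynamical
subequivalences of positive elements from `a` to `b`. -/
def DynLE (α : G →* (A ≃⋆ₐ[ℂ] A)) (a b : Stabilization A) : Prop :=
  ∃ (m : ℕ) (y : Fin (m + 1) → Stabilization A), (∀ i, 0 ≤ y i) ∧ y 0 = a ∧ y (Fin.last m) = b ∧
    ∀ i : Fin m, ElemDynLE α (y i.castSucc) (y i.succ)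

/-- Weak dynamical comparison. -/
def WeakDynamicalComparison (α : G →* (A ≃⋆ₐ[ℂ] A)) : Prop :=
  ∀ a b : Stabilization A, 0 ≤ a → 0 ≤ b → b ≠ 0 →
    (⨆ τ ∈ invTraceSpace α, dimFun τ a) < (⨅ τ ∈ invTraceSpace α, dimFun τ b) → DynLE α a b

end Dynamics

end DynComp

end

/-!
Suppose that `sup d_τ(a) < s < inf d_τ(b)` over the invariant traces `τ`, for a real number `s`.
Since all ranks are realized, there is `y ≥ 0` with `d_τ(y) = s` for every trace `τ`, and then
`a ≾₀ y ≾₀ b`. The constant function `s` is used because the intermediate element of the chain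
must not depend on `ε`.

For the first relation, fix `ε > 0`. There is a continuous affine function `c` on `T(A)` (of the
form `τ ↦ Re τ(c)` with `c ∈ A`) that dominates the rank of `(a - ε)₊` strictly and is less than
`s` on the invariant traces (`exists_dimFun_cutDown_lt`). By amenability and the weak* compactness
of `T(A)`, some average `N⁻¹ ∑ⱼ c ∘ αⱼ` over finitely many group elements is less than `s` on all
of `T(A)` (`exists_sum_lt`). Let `x` have rank `c / N`. The direct sum of `N` copies of `x` has rank
`c`, so it lies above `(a - ε)₊` by strict comparison. The direct sum of the translates `αⱼ(x)` has
as its rank the average of `c`, so it lies below `y`, and even below `(y - δ)₊` for some `δ > 0`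
because a Dini argument applies to the increasing approximations of the lower semicontinuous rank
of `y` (`exists_lt_partialTrace`).

The second relation is dual: a continuous affine `k` below the rank of `b`, strictly positive on
`T(A)` and greater than `s` on the invariant traces, is found by the same Dini argument, with
positivity coming from the faithfulness of traces on a simple algebra. A small constant is
subtracted from it and the average is taken from below.

Continuity of the functions involved rests on the projections `1 ⊗ pₙ`: the partial traces
`∑ i < n, τ(xᵢᵢ)` are continuous in `τ`, and they almost exhaust the trace of an element cut away
from `0`.

If `T(A)` is empty, strict comparison gives `a ≾₀ b` directly.
-/

noncomputable section

namespace DynComp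

universe u v

/-! ### The approximate unit of matrix projections -/

namespace FinMat

variable {A : Type u} [CStarAlgebra A]

/-- The projection `1 ⊗ pₙ` onto the first `n` coordinates. -/
def proj (n : ℕ) : FinMat A :=
  mk (fun i j => if i = j ∧ i < n then 1 else 0) ⟨n, fun i j h => if_neg (by omega)⟩

lemma star_proj (n : ℕ) : star (proj n : FinMat A) = proj n := by
  ext i j
  by_cases h : i = j
  · subst h
    by_cases hn : i < n <;> simp [proj, hn]
  · simp [proj, h, Ne.symm h]

lemma entry_proj_mul (n : ℕ) (x : FinMat A) (i j : ℕ) :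
    (proj n * x).entry i j = if i < n then x.entry i j else 0 := by
  rw [entry_mul]
  rw [finsum_eq_single _ i fun k hk => by simp [proj, hk.symm]]
  by_cases h : i < n <;> simp [proj, h]

lemma entry_mul_proj_mul (n : ℕ) (x y : FinMat A) (i j : ℕ) :
    (x * (proj n * y)).entry i j = ∑ k ∈ Finset.range n, x.entry i k * y.entry k j := by
  rw [entry_mul, finsum_eq_sum_of_support_subset (s := Finset.range n)]
  · refine Finset.sum_congr rfl fun k hk => ?_
    rw [entry_proj_mul, if_pos (Finset.mem_range.1 hk)]
  · intro k hk
    by_contra h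
    refine hk ?_
    simp only [Finset.coe_range, Set.mem_Iio] at h
    simp only [entry_proj_mul, if_neg h, mul_zero]

lemma proj_mul_self (n : ℕ) : (proj n * proj n : FinMat A) = proj n := by
  ext i j
  rw [entry_proj_mul]
  by_cases h : i < n <;> simp [proj, h]

lemma proj_mul_of_suppIn {n : ℕ} {x : FinMat A} (hx : x.SuppIn n) : proj n * x = x := by
  ext i j
  rw [entry_proj_mul]
  split_ifs with h
  · rfl
  · rw [hx i j (Or.inl (not_lt.1 h))]

end FinMat

namespace Stabilization

variable {A : Type u} [CStarAlgebra A] [PartialOrder A] [StarOrderedRing A]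

/-- The projection `1 ⊗ pₙ` in `A ⊗ 𝓚`; these form an approximate unit. -/
def proj (n : ℕ) : Stabilization A := of (FinMat.proj n)

lemma star_proj (n : ℕ) : star (proj n : Stabilization A) = proj n := by
  rw [proj, ← of_star, FinMat.star_proj]

lemma proj_mul_self (n : ℕ) : (proj n * proj n : Stabilization A) = proj n := by
  rw [proj, ← of_mul, FinMat.proj_mul_self]

lemma norm_proj_le (n : ℕ) : ‖(proj n : Stabilization A)‖ ≤ 1 := by
  have h := CStarRing.norm_star_mul_self (x := (proj n : Stabilization A))
  rw [star_proj, proj_mul_self] at h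
  nlinarith [norm_nonneg (proj n : Stabilization A)]

lemma tendsto_proj_mul (x : Stabilization A) :
    Tendsto (fun n => proj n * x) atTop (𝓝 x) := by
  rw [Metric.tendsto_atTop]
  intro ε hε
  obtain ⟨_, ⟨z, rfl⟩, hz⟩ :=
    Metric.mem_closure_iff.1 ((isDenseInducing_of (A := A)).dense x) (ε / 2) (half_pos hε)
  obtain ⟨N, hN⟩ := z.exists_suppIn
  refine ⟨N, fun n hn => ?_⟩
  have h1 : proj n * of z = of z := by
    rw [proj, ← of_mul, FinMat.proj_mul_of_suppIn (hN.mono hn)]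
  rw [dist_eq_norm] at hz ⊢
  calc ‖proj n * x - x‖ = ‖proj n * (x - of z) - (x - of z)‖ := by
        rw [mul_sub, h1]; congr 1; abel
    _ ≤ ‖proj n * (x - of z)‖ + ‖x - of z‖ := norm_sub_le _ _
    _ ≤ 1 * ‖x - of z‖ + ‖x - of z‖ := by
        gcongr
        exact (norm_mul_le _ _).trans (by gcongr; exact norm_proj_le n)
    _ < ε := by linarith

lemma tendsto_mul_proj (x : Stabilization A) :
    Tendsto (fun n => x * proj n) atTop (𝓝 x) := by
  have h := (tendsto_proj_mul (star x)).star
  simpa only [star_mul, star_star, star_proj] using h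

lemma tendsto_proj_mul_mul_proj (x : Stabilization A) :
    Tendsto (fun n => proj n * x * proj n) atTop (𝓝 x) := by
  have h : Tendsto (fun n => proj n * x * proj n - x * proj n) atTop (𝓝 0) := by
    refine squeeze_zero_norm (a := fun n => ‖proj n * x - x‖) (fun n => ?_) ?_
    · rw [← sub_mul]
      exact (norm_mul_le _ _).trans (mul_le_of_le_one_right (norm_nonneg _) (norm_proj_le n))
    · exact tendsto_iff_norm_sub_tendsto_zero.1 (tendsto_proj_mul x)
  simpa using h.add (tendsto_mul_proj x)

lemma entry_star (x : Stabilization A) (i j : ℕ) : entry i j (star x) = star (entry j i x) := by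
  refine induction_on x (isClosed_eq (by fun_prop) (by fun_prop)) fun a => ?_
  rw [← of_star, entry_of, entry_of, FinMat.entry_star]

lemma entry_proj_mul (n : ℕ) (x : Stabilization A) (i j : ℕ) :
    entry i j (proj n * x) = if i < n then entry i j x else 0 := by
  refine induction_on x (isClosed_eq (by fun_prop) ?_) fun a => ?_
  · split_ifs <;> fun_prop
  · rw [proj, ← of_mul, entry_of, entry_of, FinMat.entry_proj_mul]

lemma entry_mul_proj_mul (n : ℕ) (x y : Stabilization A) (i j : ℕ) :
    entry i j (x * (proj n * y)) = ∑ k ∈ Finset.range n, entry i k x * entry k j y := by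
  refine induction_on₂ x y (isClosed_eq (by fun_prop) (by fun_prop)) fun a b => ?_
  simp only [proj, ← of_mul, entry_of, FinMat.entry_mul_proj_mul]

lemma tendsto_sum_entry_mul (x y : Stabilization A) (i j : ℕ) :
    Tendsto (fun n => ∑ k ∈ Finset.range n, entry i k x * entry k j y) atTop
      (𝓝 (entry i j (x * y))) := by
  simp only [← entry_mul_proj_mul]
  exact ((entry i j).continuous.tendsto _).comp ((tendsto_proj_mul y).const_mul x)

lemma entry_map (φ : A →⋆ₙₐ[ℂ] A) (x : Stabilization A) (i j : ℕ) :
    entry i j (map φ x) = φ (entry i j x) := by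
  have hφ : Continuous φ := (AddMonoidHomClass.lipschitz_of_bound φ 1
    (by simpa using NonUnitalStarAlgHom.norm_apply_le φ)).continuous
  have hm : Continuous (map φ) := continuous_extendFun _
  refine induction_on x (isClosed_eq ((entry i j).continuous.comp hm)
    (hφ.comp (entry i j).continuous)) fun a => ?_
  rw [map_of, entry_of, entry_of, FinMat.entry_map]

lemma entry_shift (r : ℕ) (x : Stabilization A) (p q : ℕ) :
    entry p q (shift r x) = if p.unpair.1 = r ∧ q.unpair.1 = r then
      entry p.unpair.2 q.unpair.2 x else 0 := by
  have hm : Continuous (shift r : Stabilization A → Stabilization A) := continuous_extendFun _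
  refine induction_on x (isClosed_eq ((entry p q).continuous.comp hm) ?_) fun a => ?_
  · split_ifs <;> fun_prop
  · rw [shift_of, entry_of, entry_of]
    rfl

lemma eq_zero_of_entry {z : Stabilization A} (hz : ∀ i j, entry i j z = 0) : z = 0 := by
  obtain ⟨w, hw, hwz⟩ := mem_closure_iff_seq_limit.1 ((isDenseInducing_of (A := A)).dense z)
  choose x hx using hw
  have hxz : Tendsto (fun m => of (x m)) atTop (𝓝 z) := by simpa only [hx] using hwz
  have hn (n : ℕ) : proj n * z * proj n = 0 := by
    have h1 : Tendsto (fun m => proj n * of (x m) * proj n) atTop (𝓝 (proj n * z * proj n)) :=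
      (hxz.const_mul _).mul_const _
    refine tendsto_nhds_unique h1 ?_
    -- the topology of `Mₙ(A)` is the entrywise one
    have h2 : Tendsto (fun m => FinMat.trunc n (x m)) atTop (𝓝 0) := by
      have h3 : Tendsto (fun m => (Matrix.of fun i j : Fin n => (x m).entry i j)) atTop
          (𝓝 (0 : Matrix (Fin n) (Fin n) A)) := by
        refine tendsto_pi_nhds.2 fun i => tendsto_pi_nhds.2 fun j => ?_
        have := ((entry (A := A) i j).continuous.tendsto z).comp hxz
        simp only [Function.comp_def, hz, entry_of] at this
        exact this
      exact (CStarMatrix.ofMatrixL.continuous.tendsto _).comp h3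
    refine squeeze_zero_norm (fun m => ?_) (tendsto_zero_iff_norm_tendsto_zero.1 h2)
    have hs : (FinMat.proj n * x m * FinMat.proj n).SuppIn n := by
      intro i j hij
      rcases hij with h | h
      · rw [mul_assoc, FinMat.entry_proj_mul, if_neg (by omega)]
      · have := FinMat.entry_proj_mul n (star (x m) * FinMat.proj n) j i
        rw [if_neg (by omega)] at this
        rw [← star_star (_ * _), FinMat.entry_star]
        simp only [star_mul, FinMat.star_proj, this, star_zero]
    have ht : FinMat.trunc n (FinMat.proj n * x m * FinMat.proj n) = FinMat.trunc n (x m) := by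
      ext i j
      rw [FinMat.trunc_apply, mul_assoc, FinMat.entry_proj_mul, if_pos i.2]
      rw [← star_star (x m * _), FinMat.entry_star, star_mul, FinMat.star_proj,
        FinMat.entry_proj_mul, if_pos j.2, FinMat.entry_star, star_star, FinMat.trunc_apply]
    rw [proj, ← of_mul, ← of_mul, norm_of, FinMat.norm_eq hs, ht]
  refine tendsto_nhds_unique (tendsto_proj_mul_mul_proj z) ?_
  simp only [hn]
  exact tendsto_const_nhds

lemma ext_entry {x y : Stabilization A} (h : ∀ i j, entry i j x = entry i j y) : x = y :=
  sub_eq_zero.1 (eq_zero_of_entry fun i j => by rw [map_sub, h, sub_self])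

end Stabilization

open Stabilization

/-! ### Tracial states and their extension to the stabilization -/

section Traces

variable {A : Type u} [CStarAlgebra A] [PartialOrder A] [StarOrderedRing A] {τ : WeakDual ℂ A}

lemma exists_eq_star_mul_self {B : Type u} [NonUnitalCStarAlgebra B] [PartialOrder B]
    [StarOrderedRing B] {x : B} (hx : 0 ≤ x) : ∃ y, x = star y * y :=
  ⟨CFC.sqrt x, by rw [(CFC.sqrt_nonneg x).isSelfAdjoint.star_eq, CFC.sqrt_mul_sqrt_self x hx]⟩

lemma re_star_mul_self_nonneg (hτ : τ ∈ traceSpace A) (a : A) : 0 ≤ (τ (star a * a)).re :=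
  (Complex.le_def.1 (hτ.2.1 a)).1

lemma re_nonneg (hτ : τ ∈ traceSpace A) {a : A} (ha : 0 ≤ a) : 0 ≤ (τ a).re := by
  obtain ⟨y, rfl⟩ := exists_eq_star_mul_self ha
  exact re_star_mul_self_nonneg hτ y

lemma re_smul (τ : WeakDual ℂ A) (c : ℝ) (a : A) : (τ (c • a)).re = c * (τ a).re := by
  rw [← algebraMap_smul ℂ c a, map_smul]
  simp

lemma tendsto_re_entry_mul (τ : WeakDual ℂ A) (x y : Stabilization A) (i j : ℕ) :
    Tendsto (fun n => ∑ k ∈ Finset.range n, (τ (entry i k x * entry k j y)).re) atTop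
      (𝓝 (τ (entry i j (x * y))).re) := by
  have h := ((Complex.continuous_re.comp (map_continuous τ)).tendsto _).comp
    (tendsto_sum_entry_mul x y i j)
  simpa only [Function.comp_def, map_sum, Complex.re_sum] using h

lemma re_entry_nonneg (hτ : τ ∈ traceSpace A) {x : Stabilization A} (hx : 0 ≤ x) (i : ℕ) :
    0 ≤ (τ (entry i i x)).re := by
  obtain ⟨y, rfl⟩ := exists_eq_star_mul_self hx
  refine ge_of_tendsto' (tendsto_re_entry_mul τ (star y) y i i) fun n => ?_
  refine Finset.sum_nonneg fun k _ => ?_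
  rw [entry_star]
  exact re_star_mul_self_nonneg hτ _

lemma ofReal_re_entry_star_mul_self (hτ : τ ∈ traceSpace A) (y : Stabilization A) (i : ℕ) :
    ENNReal.ofReal (τ (entry i i (star y * y))).re =
      ∑' k, ENNReal.ofReal (τ (star (entry k i y) * entry k i y)).re := by
  refine tendsto_nhds_unique ((ENNReal.continuous_ofReal.tendsto _).comp
    (tendsto_re_entry_mul τ (star y) y i i)) ?_
  refine (ENNReal.tendsto_nat_tsum _).congr fun n => ?_
  simp only [entry_star, Function.comp_def]
  rw [ENNReal.ofReal_sum_of_nonneg fun k _ => re_star_mul_self_nonneg hτ _]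

/-- The extension of a trace to `(A ⊗ 𝓚)₊` is a trace. Both sides are the double sum of
`τ (yₖᵢ* yₖᵢ) = τ (yₖᵢ yₖᵢ*)`, whose terms are nonnegative. -/
lemma traceExt_star_mul_self_comm (hτ : τ ∈ traceSpace A) (y : Stabilization A) :
    traceExt τ (star y * y) = traceExt τ (y * star y) := by
  have h2 (i : ℕ) := ofReal_re_entry_star_mul_self hτ (star y) i
  simp only [star_star, entry_star] at h2
  simp only [traceExt, ofReal_re_entry_star_mul_self hτ, h2]
  rw [ENNReal.tsum_comm]
  simp only [hτ.2.2]

lemma traceExt_mono (hτ : τ ∈ traceSpace A) {x y : Stabilization A} (h : x ≤ y) :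
    traceExt τ x ≤ traceExt τ y := by
  refine ENNReal.tsum_le_tsum fun i => ENNReal.ofReal_le_ofReal ?_
  have := re_entry_nonneg hτ (sub_nonneg.2 h) i
  simpa using this

lemma traceExt_smul {c : ℝ} (hc : 0 ≤ c) (x : Stabilization A) :
    traceExt τ (c • x) = ENNReal.ofReal c * traceExt τ x := by
  rw [traceExt, traceExt, ← ENNReal.tsum_mul_left]
  refine tsum_congr fun i => ?_
  have h : c • x = (c : ℂ) • x := (algebraMap_smul ℂ c x).symm
  rw [← ENNReal.ofReal_mul hc, h, map_smul, Complex.coe_smul, re_smul]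

/-- The partial trace `∑ i < n, xᵢᵢ`. -/
def partialTrace (n : ℕ) (x : Stabilization A) : A := ∑ i ∈ Finset.range n, entry i i x

lemma ofReal_re_partialTrace (hτ : τ ∈ traceSpace A) {x : Stabilization A} (hx : 0 ≤ x) (n : ℕ) :
    ENNReal.ofReal (τ (partialTrace n x)).re =
      ∑ i ∈ Finset.range n, ENNReal.ofReal (τ (entry i i x)).re := by
  rw [partialTrace, map_sum, Complex.re_sum,
    ENNReal.ofReal_sum_of_nonneg fun i _ => re_entry_nonneg hτ hx i]

lemma traceExt_eq_iSup (hτ : τ ∈ traceSpace A) {x : Stabilization A} (hx : 0 ≤ x) :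
    traceExt τ x = ⨆ n, ENNReal.ofReal (τ (partialTrace n x)).re := by
  simp only [ofReal_re_partialTrace hτ hx]
  exact ENNReal.tsum_eq_iSup_nat

lemma re_partialTrace_mono (hτ : τ ∈ traceSpace A) {x y : Stabilization A} (hx : 0 ≤ x)
    (hxy : x ≤ y) {m n : ℕ} (hmn : m ≤ n) :
    (τ (partialTrace m x)).re ≤ (τ (partialTrace n y)).re := by
  simp only [partialTrace, map_sum, Complex.re_sum]
  refine (Finset.sum_le_sum_of_subset_of_nonneg (Finset.range_mono hmn)
    fun i _ _ => re_entry_nonneg hτ hx i).trans (Finset.sum_le_sum fun i _ => ?_)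
  have := re_entry_nonneg hτ (sub_nonneg.2 hxy) i
  simpa using this

lemma ofReal_re_partialTrace_le (hτ : τ ∈ traceSpace A) {x : Stabilization A} (hx : 0 ≤ x)
    (n : ℕ) : ENNReal.ofReal (τ (partialTrace n x)).re ≤ traceExt τ x := by
  rw [traceExt_eq_iSup hτ hx]
  exact le_iSup (fun n => ENNReal.ofReal (τ (partialTrace n x)).re) n

/-- Compressing by the projection `1 ⊗ pₙ` replaces the trace by the partial trace. -/
lemma traceExt_mul_proj_mul (hτ : τ ∈ traceSpace A) {y : Stabilization A} (hy : star y = y)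
    (n : ℕ) : traceExt τ (y * proj n * y) = ENNReal.ofReal (τ (partialTrace n (y * y))).re := by
  have h1 : y * proj n * y = star (proj n * y) * (proj n * y) := by
    rw [star_mul, hy, star_proj, mul_assoc, mul_assoc, ← mul_assoc (proj n) (proj n),
      proj_mul_self]
  have h2 : proj n * y * star (proj n * y) = proj n * ((y * y) * proj n) := by
    rw [star_mul, hy, star_proj]
    simp only [mul_assoc]
  have h3 (i : ℕ) : entry i i (proj n * ((y * y) * proj n)) =
      if i < n then entry i i (y * y) else 0 := by
    rw [Stabilization.entry_proj_mul]
    split_ifs with h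
    · have := Stabilization.entry_proj_mul n (y * y) i i
      rw [if_pos h] at this
      rw [← star_star (y * y * proj n), entry_star, star_mul, star_mul, star_proj, hy, this,
        ← entry_star, star_mul, hy]
    · rfl
  have hpos : 0 ≤ y * y := by simpa [hy] using star_mul_self_nonneg y
  rw [h1, traceExt_star_mul_self_comm hτ, h2, ofReal_re_partialTrace hτ hpos, traceExt,
    tsum_eq_sum (s := Finset.range n)]
  · refine Finset.sum_congr rfl fun i hi => ?_
    rw [h3, if_pos (Finset.mem_range.1 hi)]
  · intro i hi
    rw [h3, if_neg (by simpa using hi)]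
    simp

lemma traceExt_shift (τ : WeakDual ℂ A) (r : ℕ) (x : Stabilization A) :
    traceExt τ (shift r x) = traceExt τ x := by
  simp only [traceExt, entry_shift, and_self]
  have hinj : Function.Injective (Nat.pair r) := fun a b h => (Nat.pair_eq_pair.1 h).2
  rw [← hinj.tsum_eq]
  · simp
  · intro p hp
    refine ⟨p.unpair.2, ?_⟩
    by_cases h : p.unpair.1 = r
    · rw [← h, Nat.pair_unpair]
    · simp [h] at hp

lemma traceExt_add (hτ : τ ∈ traceSpace A) {x y : Stabilization A} (hx : 0 ≤ x) (hy : 0 ≤ y) :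
    traceExt τ (x + y) = traceExt τ x + traceExt τ y := by
  rw [traceExt, traceExt, traceExt, ← ENNReal.tsum_add]
  refine tsum_congr fun i => ?_
  rw [map_add, map_add, Complex.add_re,
    ENNReal.ofReal_add (re_entry_nonneg hτ hx i) (re_entry_nonneg hτ hy i)]

@[simp] lemma traceExt_zero (τ : WeakDual ℂ A) : traceExt τ 0 = 0 := by simp [traceExt]

lemma traceExt_sum (hτ : τ ∈ traceSpace A) {ι : Type*} (s : Finset ι) {x : ι → Stabilization A}
    (hx : ∀ i, 0 ≤ x i) : traceExt τ (∑ i ∈ s, x i) = ∑ i ∈ s, traceExt τ (x i) := by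
  classical
  induction s using Finset.induction_on with
  | empty => simp
  | insert i s hi ih =>
    rw [Finset.sum_insert hi, Finset.sum_insert hi,
      traceExt_add hτ (hx i) (Finset.sum_nonneg fun i _ => hx i), ih]

/-- Tracial states of a simple C*-algebra are faithful: `{a | τ (a* a) = 0}` is a closed
two-sided ideal not containing `1`. -/
lemma eq_zero_of_trace_eq_zero (hA : IsSimpleCStar A) (hτ : τ ∈ traceSpace A) {a : A}
    (ha : (τ (star a * a)).re = 0) : a = 0 := by
  have mono {x y : A} (h : x ≤ y) (hy : (τ y).re = 0) : (τ x).re ≤ 0 := by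
    have := re_nonneg hτ (sub_nonneg.2 h)
    rw [map_sub, Complex.sub_re, hy] at this
    linarith
  have left {x y : A} (hy : (τ (star y * y)).re = 0) : (τ (star (x * y) * (x * y))).re = 0 := by
    refine le_antisymm (mono (y := ‖star x * x‖ • (star y * y)) ?_ ?_)
      (re_star_mul_self_nonneg hτ _)
    · have := CStarAlgebra.star_left_conjugate_le_norm_smul (a := y) (b := star x * x)
      simpa only [star_mul, mul_assoc] using this
    · rw [re_smul, hy, mul_zero]
  have hstar {x : A} (hx : (τ (star x * x)).re = 0) :
      (τ (star (star x) * star x)).re = 0 := by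
    rw [star_star, hτ.2.2, hx]
  let I : TwoSidedIdeal A := TwoSidedIdeal.mk' {x | (τ (star x * x)).re = 0} (by simp)
    (fun {x y} hx hy => by
      refine le_antisymm (mono (y := (2 : ℝ) • (star x * x + star y * y)) ?_ ?_)
        (re_star_mul_self_nonneg hτ _)
      · rw [← sub_nonneg]
        have e : (2 : ℝ) • (star x * x + star y * y) - star (x + y) * (x + y) =
            star (x - y) * (x - y) := by
          rw [two_smul, star_add, star_sub]
          noncomm_ring
        rw [e]
        exact star_mul_self_nonneg _
      · rw [re_smul, map_add, Complex.add_re, hx, hy]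
        simp)
    (fun {x} hx => by simpa using hx) (fun {x y} hy => left hy)
    (fun {x y} hx => by
      have := hstar (left (x := star y) (hstar hx))
      rw [star_star, ← star_mul, star_star] at this
      exact this)
  have hI : IsClosed (I : Set A) := by
    rw [TwoSidedIdeal.coe_mk']
    have hc : Continuous fun x : A => (τ (star x * x)).re :=
      Complex.continuous_re.comp ((map_continuous τ).comp (by fun_prop))
    exact isClosed_eq hc continuous_const
  rcases hA.2 I hI with h | h
  · have : a ∈ I := (TwoSidedIdeal.mem_mk' ..).2 ha
    rwa [h, TwoSidedIdeal.mem_bot] at this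
  · have : (1 : A) ∈ I := h ▸ TwoSidedIdeal.mem_top (R := A)
    rw [← SetLike.mem_coe, TwoSidedIdeal.coe_mk'] at this
    have h1 : (τ (star (1 : A) * 1)).re = 0 := this
    simp [hτ.1] at h1

lemma norm_trace_apply_le (hτ : τ ∈ traceSpace A) (a : A) : ‖τ a‖ ≤ 2 * ‖a‖ := by
  -- a positive functional is bounded by `τ 1` on the self-adjoint part
  have hre {x : A} (hx : IsSelfAdjoint x) : |(τ x).re| ≤ ‖x‖ := by
    have e : (τ (algebraMap ℝ A ‖x‖)).re = ‖x‖ := by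
      rw [Algebra.algebraMap_eq_smul_one, re_smul, hτ.1]
      simp
    have h1 := re_nonneg hτ (sub_nonneg.2 hx.le_algebraMap_norm_self)
    have h2 := re_nonneg hτ (sub_nonneg.2 hx.neg_algebraMap_norm_le_self)
    rw [map_sub, Complex.sub_re, e] at h1
    rw [map_sub, map_neg, Complex.sub_re, Complex.neg_re, e] at h2
    exact abs_le.2 ⟨by linarith, by linarith⟩
  have hre' (x : A) : |(τ x).re| ≤ ‖x‖ := by
    have h1 := (Complex.le_def.1 (hτ.2.1 (1 + Complex.I • x))).2
    have h2 := (Complex.le_def.1 (hτ.2.1 x)).2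
    -- `τ x` and `τ x*` have the same real part, as `τ ((1 + ix)* (1 + ix))` is real
    have h3 : (τ x).re = (τ (star x)).re := by
      have e : star (1 + Complex.I • x) * (1 + Complex.I • x) =
          1 + Complex.I • x - Complex.I • star x + star x * x := by
        simp only [star_add, star_one, star_smul, add_mul, mul_add, smul_mul_assoc,
          mul_smul_comm, one_mul, mul_one]
        have hI : Complex.I • Complex.I • (star x * x) = -(star x * x) := by
          rw [smul_smul, Complex.I_mul_I, neg_one_smul]
        simp [hI]
        abel
      rw [e] at h1
      simp [hτ.1] at h1 h2
      linarith
    have h4 := hre (IsSelfAdjoint.add_star_self x)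
    rw [map_add, Complex.add_re, ← h3, ← two_mul, abs_mul, abs_two] at h4
    have h5 := norm_add_le x (star x)
    rw [norm_star] at h5
    linarith
  have h1 := hre' a
  have h2 := hre' (Complex.I • a)
  rw [map_smul, norm_smul, Complex.norm_I, one_mul] at h2
  simp at h2
  have := Complex.norm_le_abs_re_add_abs_im (τ a)
  linarith

/-- The weak* compactness of `T(A)`, from the Banach–Alaoglu theorem. -/
lemma isCompact_traceSpace : IsCompact (traceSpace A) := by
  have hev (a : A) : Continuous fun τ : WeakDual ℂ A => τ a := WeakDual.eval_continuous a
  have hclosed : IsClosed (traceSpace A) := by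
    have e : traceSpace A = {τ | τ 1 = 1} ∩ (⋂ a, {τ | 0 ≤ τ (star a * a)}) ∩
        ⋂ a, ⋂ b, {τ | τ (a * b) = τ (b * a)} := by
      ext τ
      simp [traceSpace, and_assoc]
    rw [e]
    exact ((isClosed_eq (hev 1) continuous_const).inter
      (isClosed_iInter fun a => isClosed_le continuous_const (hev _))).inter
      (isClosed_iInter fun a => isClosed_iInter fun b => isClosed_eq (hev _) (hev _))
  refine (WeakDual.isCompact_closedBall (𝕜 := ℂ) (E := A) 0 2).of_isClosed_subset hclosed
    fun τ hτ => ?_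
  rw [Set.mem_preimage, mem_closedBall_zero_iff]
  exact ContinuousLinearMap.opNorm_le_bound _ zero_le_two (norm_trace_apply_le hτ)

lemma traceExt_pos (hA : IsSimpleCStar A) (hτ : τ ∈ traceSpace A) {x : Stabilization A}
    (hx : 0 ≤ x) (hx0 : x ≠ 0) : 0 < traceExt τ x := by
  obtain ⟨y, rfl⟩ := exists_eq_star_mul_self hx
  rw [pos_iff_ne_zero]
  intro h
  refine hx0 ?_
  suffices y = 0 by rw [this, mul_zero]
  refine eq_zero_of_entry fun k i => eq_zero_of_trace_eq_zero hA hτ ?_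
  rw [traceExt, ENNReal.tsum_eq_zero] at h
  have h1 := h i
  rw [ofReal_re_entry_star_mul_self hτ, ENNReal.tsum_eq_zero] at h1
  exact le_antisymm (ENNReal.ofReal_eq_zero.1 (h1 k)) (re_star_mul_self_nonneg hτ _)

end Traces

/-! ### Functional calculus with ramp functions -/

section Ramp

@[fun_prop] lemma continuous_rampFun (n : ℕ) : Continuous (rampFun n) := by
  unfold rampFun; fun_prop

@[simp] lemma rampFun_zero (n : ℕ) : rampFun n 0 = 0 := by simp [rampFun]

lemma rampFun_nonneg (n : ℕ) (x : ℝ) : 0 ≤ rampFun n x := by simp [rampFun]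

lemma rampFun_le_one (n : ℕ) (x : ℝ) : rampFun n x ≤ 1 := min_le_left _ _

lemma rampFun_eq_one {n : ℕ} {x : ℝ} (h : 2 ≤ n * x) : rampFun n x = 1 :=
  min_eq_left (le_max_of_le_right (by linarith))

lemma rampFun_eq_zero {n : ℕ} {x : ℝ} (h : n * x ≤ 1) : rampFun n x = 0 := by
  rw [rampFun, max_eq_left (by linarith), min_eq_right zero_le_one]

lemma rampFun_mono {m n : ℕ} (hmn : m ≤ n) {x : ℝ} (hx : 0 ≤ x) : rampFun m x ≤ rampFun n x := by
  unfold rampFun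
  have : (m : ℝ) ≤ n := by exact_mod_cast hmn
  gcongr

variable {B : Type u} [NonUnitalCStarAlgebra B] [PartialOrder B] [StarOrderedRing B] {b : B}

lemma cfcₙ_rampFun_nonneg (n : ℕ) (b : B) : 0 ≤ cfcₙ (rampFun n) b :=
  cfcₙ_nonneg fun x _ => rampFun_nonneg n x

lemma cfcₙ_rampFun_mono (hb : 0 ≤ b) {m n : ℕ} (hmn : m ≤ n) :
    cfcₙ (rampFun m) b ≤ cfcₙ (rampFun n) b :=
  cfcₙ_mono fun _ hx => rampFun_mono hmn (quasispectrum_nonneg_of_nonneg b hb _ hx)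

lemma cutDown_nonneg (b : B) (ε : ℝ) : 0 ≤ cutDown b ε :=
  cfcₙ_nonneg fun _ _ => le_max_right _ _

lemma cfcₙ_rampFun_cutDown (hb : 0 ≤ b) (n : ℕ) {ε : ℝ} (hε : 0 < ε) :
    cfcₙ (rampFun n) (cutDown b ε) = cfcₙ (fun x => rampFun n (max (x - ε) 0)) b :=
  (cfcₙ_comp' (rampFun n) (fun x : ℝ => max (x - ε) 0) b
    (hf0 := by simp [hε.le])).symm

lemma cfcₙ_rampFun_cutDown_le (hb : 0 ≤ b) {ε : ℝ} (hε : 0 < ε) {m : ℕ} (hm : 2 ≤ m * ε)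
    (n : ℕ) : cfcₙ (rampFun n) (cutDown b ε) ≤ cfcₙ (rampFun m) b := by
  rw [cfcₙ_rampFun_cutDown hb n hε]
  refine cfcₙ_mono (fun x hx => ?_) (hf0 := by simp [hε.le])
  rcases le_total x ε with h | h
  · rw [max_eq_right (by linarith), rampFun_zero]
    exact rampFun_nonneg _ _
  · rw [rampFun_eq_one (n := m) (hm.trans (by gcongr))]
    exact rampFun_le_one _ _

lemma exists_cfcₙ_rampFun_le_cutDown (hb : 0 ≤ b) (m : ℕ) :
    ∃ δ : ℝ, 0 < δ ∧ ∃ n : ℕ, cfcₙ (rampFun m) b ≤ cfcₙ (rampFun n) (cutDown b δ) := by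
  refine ⟨1 / (2 * (m + 1)), by positivity, 4 * (m + 1), ?_⟩
  have hδ : (0 : ℝ) < 1 / (2 * (m + 1)) := by positivity
  rw [cfcₙ_rampFun_cutDown hb _ hδ]
  refine cfcₙ_mono (fun x hx => ?_)
    (hg0 := by simp only [zero_sub, max_eq_right (neg_nonpos.2 hδ.le), rampFun_zero])
  rcases le_total (m * x) 1 with h | h
  · rw [rampFun_eq_zero h]
    exact rampFun_nonneg _ _
  · refine (rampFun_le_one _ _).trans_eq (rampFun_eq_one ?_).symm
    have hx0 : 0 ≤ x := quasispectrum_nonneg_of_nonneg b hb x hx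
    have h2 : (1 : ℝ) / (m + 1) ≤ x := by
      rw [div_le_iff₀ (by positivity)]
      nlinarith
    have h3 : (1 : ℝ) / (2 * (m + 1)) = 1 / (m + 1) / 2 := by field_simp
    have h4 : ((m : ℝ) + 1) * (1 / (m + 1)) = 1 := by field_simp
    refine le_trans ?_ (mul_le_mul_of_nonneg_left (le_max_left _ _) (by positivity))
    push_cast
    rw [h3]
    nlinarith

lemma exists_cfcₙ_rampFun_ne_zero (hb : 0 ≤ b) (hb0 : b ≠ 0) : ∃ n, cfcₙ (rampFun n) b ≠ 0 := by
  by_contra! h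
  refine hb0 ?_
  -- `x - x * rampFun n x` is at most `2 / n`, so that `b = lim b * rampFun n b = 0`
  have hle (n : ℕ) : ‖b‖ ≤ 2 / ((n : ℝ) + 1) := by
    have h1 : cfcₙ (fun x : ℝ => x - x * rampFun (n + 1) x) b = b := by
      rw [cfcₙ_sub (fun x : ℝ => x) (fun x : ℝ => x * rampFun (n + 1) x) b,
        cfcₙ_mul (fun x : ℝ => x) (rampFun (n + 1)) b, h, mul_zero, sub_zero, cfcₙ_id' ℝ b]
    rw [← h1]
    refine norm_cfcₙ_le fun x hx => ?_
    have hx0 : 0 ≤ x := quasispectrum_nonneg_of_nonneg b hb x hx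
    have e : x - x * rampFun (n + 1) x = x * (1 - rampFun (n + 1) x) := by ring
    have h2 := rampFun_le_one (n + 1) x
    have h3 := rampFun_nonneg (n + 1) x
    rw [e, Real.norm_of_nonneg (mul_nonneg hx0 (by linarith)), le_div_iff₀ (by positivity)]
    rcases le_total 2 (((n + 1 : ℕ) : ℝ) * x) with h4 | h4
    · rw [rampFun_eq_one h4]
      simp
    · push_cast at h4
      nlinarith [mul_nonneg hx0 h3, mul_nonneg (mul_nonneg hx0 h3) (by positivity : (0:ℝ) ≤ n + 1)]
  have hlim : Tendsto (fun n : ℕ => 2 / ((n : ℝ) + 1)) atTop (𝓝 0) := by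
    simpa [Function.comp_def] using
      (tendsto_const_div_atTop_nhds_zero_nat (2 : ℝ)).comp (tendsto_add_atTop_nat 1)
  exact norm_le_zero_iff.1 (ge_of_tendsto' hlim hle)

end Ramp

/-! ### Dimension functions -/

section DimFun

variable {A : Type u} [CStarAlgebra A] [PartialOrder A] [StarOrderedRing A] {τ : WeakDual ℂ A}
  {a b : Stabilization A}

@[simp] lemma dimFun_zero (τ : WeakDual ℂ A) : dimFun τ (0 : Stabilization A) = 0 := by
  simp [dimFun]

lemma traceExt_cfcₙ_rampFun_le_dimFun (τ : WeakDual ℂ A) (a : Stabilization A) (n : ℕ) :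
    traceExt τ (cfcₙ (rampFun n) a) ≤ dimFun τ a :=
  le_iSup (fun n => traceExt τ (cfcₙ (rampFun n) a)) n

lemma dimFun_cutDown_le (hτ : τ ∈ traceSpace A) (ha : 0 ≤ a) {ε : ℝ} (hε : 0 < ε) {m : ℕ}
    (hm : 2 ≤ m * ε) : dimFun τ (cutDown a ε) ≤ traceExt τ (cfcₙ (rampFun m) a) :=
  iSup_le fun n => traceExt_mono hτ (cfcₙ_rampFun_cutDown_le ha hε hm n)

lemma exists_traceExt_le_dimFun_cutDown (hb : 0 ≤ b) (m : ℕ) :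
    ∃ δ : ℝ, 0 < δ ∧ ∀ τ ∈ traceSpace A,
      traceExt τ (cfcₙ (rampFun m) b) ≤ dimFun τ (cutDown b δ) := by
  obtain ⟨δ, hδ, n, hn⟩ := exists_cfcₙ_rampFun_le_cutDown hb m
  exact ⟨δ, hδ, fun τ hτ => (traceExt_mono hτ hn).trans (traceExt_cfcₙ_rampFun_le_dimFun _ _ _)⟩

lemma dimFun_pos (hA : IsSimpleCStar A) (hτ : τ ∈ traceSpace A) (hb : 0 ≤ b) (hb0 : b ≠ 0) :
    0 < dimFun τ b := by
  obtain ⟨n, hn⟩ := exists_cfcₙ_rampFun_ne_zero hb hb0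
  exact (traceExt_pos hA hτ (cfcₙ_rampFun_nonneg n b) hn).trans_le
    (traceExt_cfcₙ_rampFun_le_dimFun _ _ _)

lemma continuous_shift (r : ℕ) : Continuous (shift r : Stabilization A → Stabilization A) :=
  continuous_extendFun _

lemma shift_mul_shift_of_ne {r s : ℕ} (hrs : r ≠ s) (x y : Stabilization A) :
    shift r x * shift s y = 0 := by
  refine ext_entry fun p q => tendsto_nhds_unique (tendsto_sum_entry_mul _ _ p q) ?_
  have h (k : ℕ) : entry p k (shift r x) * entry k q (shift s y) = 0 := by
    rw [entry_shift, entry_shift]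
    by_cases hk : k.unpair.1 = r
    · rw [if_neg (c := k.unpair.1 = s ∧ _) fun h => hrs (hk.symm.trans h.1), mul_zero]
    · rw [if_neg fun h => hk h.2, zero_mul]
  simp only [h, Finset.sum_const_zero, map_zero]
  exact tendsto_const_nhds

lemma dirSum_mul {n : ℕ} (x y : Fin n → Stabilization A) :
    dirSum (x * y) = dirSum x * dirSum y := by
  unfold dirSum
  rw [Finset.sum_mul_sum]
  refine Finset.sum_congr rfl fun i _ => ?_
  rw [Finset.sum_eq_single_of_mem i (Finset.mem_univ i) fun j _ hj =>
    shift_mul_shift_of_ne (fun h => hj (Fin.ext h).symm) _ _]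
  exact map_mul (shift (i : ℕ)) (x i) (y i)

/-- The direct sum as a `*`-homomorphism on the product C*-algebra. -/
def dirSumHom (A : Type u) [CStarAlgebra A] [PartialOrder A] [StarOrderedRing A] (n : ℕ) :
    (Fin n → Stabilization A) →⋆ₙₐ[ℂ] Stabilization A where
  toFun := dirSum
  map_smul' c x :=
    (Finset.sum_congr rfl fun (j : Fin n) _ => map_smul (shift (j : ℕ)) c (x j)).trans
      Finset.smul_sum.symm
  map_zero' := Finset.sum_eq_zero fun j _ => map_zero (shift (j : ℕ))
  map_add' x y :=
    (Finset.sum_congr rfl fun (j : Fin n) _ => map_add (shift (j : ℕ)) (x j) (y j)).trans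
      Finset.sum_add_distrib
  map_mul' := dirSum_mul
  map_star' x :=
    (Finset.sum_congr rfl fun (j : Fin n) _ => map_star (shift (j : ℕ)) (x j)).trans
      (star_sum _ _).symm

lemma dirSum_nonneg {n : ℕ} {x : Fin n → Stabilization A} (hx : ∀ j, 0 ≤ x j) :
    0 ≤ dirSum x :=
  Finset.sum_nonneg fun j _ => map_nonneg (shift (j : ℕ)) (hx j)

lemma cfcₙ_dirSum {n : ℕ} {x : Fin n → Stabilization A} (hx : ∀ j, 0 ≤ x j) (m : ℕ) :
    cfcₙ (rampFun m) (dirSum x) = dirSum fun j => cfcₙ (rampFun m) (x j) := by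
  have hsa : IsSelfAdjoint x := funext fun j => (hx j).isSelfAdjoint.star_eq
  have hcont : Continuous (dirSumHom A n) := by
    change Continuous fun x : Fin n → Stabilization A => dirSum x
    exact continuous_finsetSum _ fun j _ => (continuous_shift _).comp (continuous_apply j)
  have h1 := (dirSumHom A n).map_cfcₙ (rampFun m) x (hφ := hcont) (ha := hsa)
    (hφa := (dirSum_nonneg hx).isSelfAdjoint)
  have h2 := cfcₙ_map_pi (S := ℂ) (rampFun m) x (ha := hsa)
    (ha' := fun j => (hx j).isSelfAdjoint)
  rw [h2] at h1
  exact h1.symm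

lemma dimFun_dirSum (hτ : τ ∈ traceSpace A) {n : ℕ} {x : Fin n → Stabilization A}
    (hx : ∀ j, 0 ≤ x j) : dimFun τ (dirSum x) = ∑ j, dimFun τ (x j) := by
  have h (m : ℕ) : traceExt τ (cfcₙ (rampFun m) (dirSum x)) =
      ∑ j, traceExt τ (cfcₙ (rampFun m) (x j)) := by
    rw [cfcₙ_dirSum hx, dirSum, traceExt_sum hτ _ fun j : Fin n =>
      map_nonneg (shift (j : ℕ)) (cfcₙ_rampFun_nonneg m (x j))]
    simp only [traceExt_shift]
  simp only [dimFun, h]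
  refine (ENNReal.finsetSum_iSup_of_monotone fun j m k hmk => ?_).symm
  exact traceExt_mono hτ (cfcₙ_rampFun_mono (hx j) hmk)

/-- The composition of a functional with an automorphism. -/
def pullback (φ : A ≃⋆ₐ[ℂ] A) (τ : WeakDual ℂ A) : WeakDual ℂ A :=
  ContinuousLinearMap.comp (WeakDual.toStrongDual τ)
    (⟨((φ : A →⋆ₙₐ[ℂ] A) : A →ₗ[ℂ] A), (AddMonoidHomClass.lipschitz_of_bound φ 1
      (by simpa using NonUnitalStarAlgHom.norm_apply_le φ)).continuous⟩ : A →L[ℂ] A)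

@[simp] lemma pullback_apply (φ : A ≃⋆ₐ[ℂ] A) (τ : WeakDual ℂ A) (a : A) :
    pullback φ τ a = τ (φ a) := rfl

lemma pullback_mem (φ : A ≃⋆ₐ[ℂ] A) (hτ : τ ∈ traceSpace A) : pullback φ τ ∈ traceSpace A := by
  refine ⟨?_, fun a => ?_, fun a b => ?_⟩
  · rw [pullback_apply, map_one, hτ.1]
  · rw [pullback_apply, map_mul, map_star]
    exact hτ.2.1 _
  · rw [pullback_apply, map_mul, hτ.2.2, ← map_mul, pullback_apply]

variable {G : Type v} [Group G] (α : G →* (A ≃⋆ₐ[ℂ] A))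

lemma continuous_stabAct (g : G) : Continuous (stabAct α g) := continuous_extendFun _

lemma stabAct_nonneg (g : G) (ha : 0 ≤ a) : 0 ≤ stabAct α g a := map_nonneg (stabAct α g) ha

lemma dimFun_stabAct (g : G) (ha : 0 ≤ a) (τ : WeakDual ℂ A) :
    dimFun τ (stabAct α g a) = dimFun (pullback (α g) τ) a := by
  unfold dimFun
  refine iSup_congr fun n => ?_
  rw [← (stabAct α g).map_cfcₙ (rampFun n) a (hφ := continuous_stabAct α g)
    (ha := ha.isSelfAdjoint) (hφa := (stabAct_nonneg α g ha).isSelfAdjoint)]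
  refine tsum_congr fun i => ?_
  rw [stabAct, entry_map]
  rfl

lemma stabAct_inv_stabAct (g : G) (x : Stabilization A) :
    stabAct α g⁻¹ (stabAct α g x) = x := by
  refine ext_entry fun i j => ?_
  rw [stabAct, stabAct, entry_map, entry_map]
  change (α g⁻¹ * α g) (entry i j x) = entry i j x
  rw [← map_mul, inv_mul_cancel, map_one]
  rfl

/-- The upper estimate: the rank function of a cut-down of `a` is dominated by a continuous affine
function that is not much larger than the rank function of `a`. -/
lemma exists_dimFun_cutDown_lt (ha : 0 ≤ a) {ε : ℝ} (hε : 0 < ε) {S s : ℝ} (hS : 0 ≤ S)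
    (hSs : S < s) :
    ∃ c : A, (∀ τ ∈ traceSpace A,
        dimFun τ (cutDown a ε) < ENNReal.ofReal (τ c).re) ∧
      ∀ τ ∈ traceSpace A, dimFun τ a ≤ ENNReal.ofReal S → (τ c).re < s := by
  obtain ⟨m, hm⟩ := exists_nat_ge (2 / ε)
  have hm' : 2 ≤ m * ε := (div_le_iff₀ hε).1 hm
  set q := cfcₙ (rampFun m) a with hq
  set y := cfcₙ (fun x => √(rampFun m x)) a with hy
  set e := cfcₙ (rampFun (2 * m)) a with he
  have hq0 : 0 ≤ q := cfcₙ_rampFun_nonneg m a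
  have hysa : star y = y := (cfcₙ_nonneg fun x _ => Real.sqrt_nonneg _).isSelfAdjoint.star_eq
  have hesa : IsSelfAdjoint e := (cfcₙ_rampFun_nonneg _ a).isSelfAdjoint
  have hyy : y * y = q := by
    rw [hy, hq, ← cfcₙ_mul _ _ a]
    exact cfcₙ_congr fun x _ => Real.mul_self_sqrt (rampFun_nonneg m x)
  -- `e` is a local unit for `y`
  have hyey : y * e * y = q := by
    rw [← hyy]
    congr 1
    rw [hy, he, ← cfcₙ_mul _ _ a]
    refine cfcₙ_congr fun x _ => ?_
    rcases le_total (m * x) 1 with h | h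
    · simp [rampFun_eq_zero h]
    · rw [rampFun_eq_one (n := 2 * m) (by push_cast; linarith), mul_one]
  have he1 : ‖e‖ ≤ 1 := norm_cfcₙ_le fun x _ => by
    rw [Real.norm_of_nonneg (rampFun_nonneg _ _)]
    exact rampFun_le_one _ _
  -- `t > 1` is so close to `1` that `t * S + t' < s`
  set t : ℝ := 1 + (s - S) / (4 * (S + 1)) with ht
  have hd : 0 < (s - S) / (4 * (S + 1)) := div_pos (by linarith) (by linarith)
  have htS : t * S < (S + s) / 2 := by
    have h1 : (s - S) / (4 * (S + 1)) * (4 * (S + 1)) = s - S := by field_simp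
    nlinarith
  have ht1 : 1 < t := by linarith
  have ht0 : 0 < t := by linarith
  have hη : 0 < 1 - t⁻¹ := sub_pos.2 (inv_lt_one_of_one_lt₀ ht1)
  obtain ⟨n, hn⟩ := ((Metric.tendsto_atTop.1 (tendsto_proj_mul_mul_proj e)) _ hη)
  specialize hn n le_rfl
  rw [dist_comm, dist_eq_norm] at hn
  have hpe : IsSelfAdjoint (proj n * e * proj n) := by
    rw [IsSelfAdjoint, star_mul, star_mul, star_proj, hesa.star_eq, mul_assoc]
  have h1 : y * (e - proj n * e * proj n) * y ≤ (1 - t⁻¹) • q := by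
    have h := CStarAlgebra.star_left_conjugate_le_norm_smul (a := y) (hesa.sub hpe)
    rw [hysa, hyy] at h
    exact h.trans (smul_le_smul_of_nonneg_right hn.le hq0)
  have h2 : y * (proj n * e * proj n) * y ≤ y * proj n * y := by
    have h := CStarAlgebra.star_left_conjugate_le_norm_smul (a := proj n * y) hesa
    have e1 : star (proj n * y) * (proj n * y) = y * proj n * y := by
      rw [star_mul, hysa, star_proj, mul_assoc, mul_assoc, ← mul_assoc (proj n) (proj n),
        proj_mul_self]
    have e2 : star (proj n * y) * e * (proj n * y) = y * (proj n * e * proj n) * y := by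
      rw [star_mul, hysa, star_proj]
      simp only [mul_assoc]
    have hpos : 0 ≤ y * proj n * y := e1 ▸ star_mul_self_nonneg _
    rw [e1, e2] at h
    refine h.trans ?_
    simpa using smul_le_smul_of_nonneg_right he1 hpos
  have h3 : t⁻¹ • q ≤ y * proj n * y := by
    have h := add_le_add h1 h2
    have e1 : y * (e - proj n * e * proj n) * y + y * (proj n * e * proj n) * y = q := by
      rw [← add_mul, ← mul_add, sub_add_cancel, hyey]
    rw [e1, sub_smul, one_smul, sub_add_eq_add_sub, le_sub_iff_add_le] at h
    exact le_of_add_le_add_left h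
  have h4 : ∀ τ ∈ traceSpace A, traceExt τ q ≤ ENNReal.ofReal (t * (τ (partialTrace n q)).re) := by
    intro τ hτ
    have h := traceExt_mono hτ h3
    rw [traceExt_mul_proj_mul hτ hysa, hyy, traceExt_smul (by positivity)] at h
    rw [ENNReal.ofReal_mul ht0.le]
    calc traceExt τ q = ENNReal.ofReal t * (ENNReal.ofReal t⁻¹ * traceExt τ q) := by
          rw [← mul_assoc, ← ENNReal.ofReal_mul ht0.le, mul_inv_cancel₀ ht0.ne']
          simp
      _ ≤ _ := by gcongr
  have hc (τ) (hτ : τ ∈ traceSpace A) : (τ (t • partialTrace n q + ((s - S) / 2) • 1)).re =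
      t * (τ (partialTrace n q)).re + (s - S) / 2 := by
    rw [map_add, Complex.add_re, re_smul, re_smul, hτ.1]
    simp
  have hpos (τ) (hτ : τ ∈ traceSpace A) : 0 ≤ (τ (partialTrace n q)).re := by
    simpa [partialTrace] using re_partialTrace_mono hτ hq0 le_rfl (Nat.zero_le n)
  refine ⟨t • partialTrace n q + ((s - S) / 2) • 1, fun τ hτ => ?_, fun τ hτ h => ?_⟩
  · refine ((dimFun_cutDown_le hτ ha hε hm').trans (h4 τ hτ)).trans_lt ?_
    rw [hc τ hτ]
    have := mul_nonneg ht0.le (hpos τ hτ)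
    exact (ENNReal.ofReal_lt_ofReal_iff (by linarith)).2 (by linarith)
  · have h5 : (τ (partialTrace n q)).re ≤ S := by
      rw [← ENNReal.ofReal_le_ofReal_iff hS]
      refine le_trans ?_ ((traceExt_cfcₙ_rampFun_le_dimFun τ a m).trans h)
      exact ofReal_re_partialTrace_le hτ hq0 n
    rw [hc τ hτ]
    have := mul_le_mul_of_nonneg_left h5 ht0.le
    linarith

/-- The lower estimate: on a compact set of traces, a continuous affine function below the rank
function of `b` is below one of the continuous affine functions that increase to that rank
function. -/
lemma exists_lt_partialTrace {K : Set (WeakDual ℂ A)} (hK : IsCompact K) (hKT : K ⊆ traceSpace A)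
    (hb : 0 ≤ b) (c : A) (hc0 : ∀ τ ∈ K, 0 ≤ (τ c).re)
    (hc : ∀ τ ∈ K, ENNReal.ofReal (τ c).re < dimFun τ b) :
    ∃ N, ∀ n ≥ N, ∀ τ ∈ K, (τ c).re < (τ (partialTrace n (cfcₙ (rampFun n) b))).re := by
  have hev (c : A) : Continuous fun τ : WeakDual ℂ A => (τ c).re :=
    Complex.continuous_re.comp (WeakDual.eval_continuous c)
  obtain ⟨N, hN⟩ := hK.elim_directed_cover
    (fun n => {τ | (τ c).re < (τ (partialTrace n (cfcₙ (rampFun n) b))).re} ∪ (traceSpace A)ᶜ)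
    (fun n => (isOpen_lt (hev _) (hev _)).union isCompact_traceSpace.isClosed.isOpen_compl)
    (fun τ hτ => by
      have h := hc τ hτ
      rw [dimFun, lt_iSup_iff] at h
      obtain ⟨m, hm⟩ := h
      rw [traceExt_eq_iSup (hKT hτ) (cfcₙ_rampFun_nonneg m b), lt_iSup_iff] at hm
      obtain ⟨n, hn⟩ := hm
      refine Set.mem_iUnion.2 ⟨max m n, Or.inl ?_⟩
      refine ((ENNReal.ofReal_lt_ofReal_iff_of_nonneg (hc0 τ hτ)).1 hn).trans_le ?_
      exact re_partialTrace_mono (hKT hτ) (cfcₙ_rampFun_nonneg m b)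
        (cfcₙ_rampFun_mono hb (le_max_left m n)) (le_max_right m n))
    (directed_of_isDirected_le fun m n hmn τ hτ => by
      by_cases hT : τ ∈ traceSpace A
      · refine Or.inl ?_
        refine (show (τ c).re < _ from hτ.resolve_right (not_not_intro hT)).trans_le ?_
        exact re_partialTrace_mono hT (cfcₙ_rampFun_nonneg m b) (cfcₙ_rampFun_mono hb hmn) hmn
      · exact Or.inr hT)
  refine ⟨N, fun n hn τ hτ => ?_⟩
  refine ((hN hτ).resolve_right (not_not_intro (hKT hτ))).trans_le ?_
  exact re_partialTrace_mono (hKT hτ) (cfcₙ_rampFun_nonneg N b) (cfcₙ_rampFun_mono hb hn) hn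

end DimFun

/-! ### Averaging over Følner sets -/

section Averaging

open scoped Pointwise symmDiff

variable {A : Type u} [CStarAlgebra A] [PartialOrder A] [StarOrderedRing A]
  {G : Type v} [Group G]

lemma norm_sum_sub_sum_le {ι E : Type*} [DecidableEq ι] [SeminormedAddCommGroup E]
    (S T : Finset ι) {f : ι → E} {C : ℝ} (hf : ∀ i, ‖f i‖ ≤ C) :
    ‖∑ i ∈ S, f i - ∑ i ∈ T, f i‖ ≤ (S ∆ T).card * C := by
  have hcard : (S ∆ T).card = (S \ T).card + (T \ S).card :=
    Finset.card_union_of_disjoint disjoint_sdiff_sdiff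
  have h (U : Finset ι) : ‖∑ i ∈ U, f i‖ ≤ U.card * C := by
    simpa using norm_sum_le_of_le U fun i _ => hf i
  rw [← Finset.sum_sdiff_sub_sum_sdiff, hcard, Nat.cast_add, add_mul]
  exact (norm_sub_le _ _).trans (add_le_add (h _) (h _))

/-- The average of the translates of a functional by the inverses of the elements of `F`. -/
def average (α : G →* (A ≃⋆ₐ[ℂ] A)) (F : Finset G) (τ : WeakDual ℂ A) : WeakDual ℂ A :=
  (F.card : ℂ)⁻¹ • ∑ g ∈ F, pullback (α g⁻¹) τ

lemma average_apply (α : G →* (A ≃⋆ₐ[ℂ] A)) (F : Finset G) (τ : WeakDual ℂ A) (a : A) :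
    average α F τ a = (F.card : ℂ)⁻¹ * ∑ g ∈ F, τ (α g⁻¹ a) := by
  have h : (∑ g ∈ F, pullback (α g⁻¹) τ) a = ∑ g ∈ F, τ (α g⁻¹ a) :=
    map_sum (⟨⟨fun σ => σ a, rfl⟩, fun _ _ => rfl⟩ : WeakDual ℂ A →+ ℂ) _ F
  rw [← h]
  rfl

lemma average_mem (α : G →* (A ≃⋆ₐ[ℂ] A)) {F : Finset G} (hF : F.Nonempty) {τ : WeakDual ℂ A}
    (hτ : τ ∈ traceSpace A) : average α F τ ∈ traceSpace A := by
  have hcard : (F.card : ℂ) ≠ 0 := by exact_mod_cast hF.card_pos.ne'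
  refine ⟨?_, fun a => ?_, fun a b => ?_⟩
  · simp [average_apply, hτ.1, hcard]
  · rw [average_apply]
    refine mul_nonneg (by rw [← Complex.ofReal_natCast, ← Complex.ofReal_inv,
      Complex.zero_le_real]; positivity) (Finset.sum_nonneg fun g _ => ?_)
    exact (pullback_mem (α g⁻¹) hτ).2.1 a
  · simp only [average_apply]
    congr 1
    exact Finset.sum_congr rfl fun g _ => (pullback_mem (α g⁻¹) hτ).2.2 a b

lemma norm_average_sub_le (α : G →* (A ≃⋆ₐ[ℂ] A)) [DecidableEq G] (F : Finset G) {τ : WeakDual ℂ A}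
    (hτ : τ ∈ traceSpace A) (g : G) (a : A) :
    ‖average α F τ (α g a) - average α F τ a‖ ≤
      ((F.image (g⁻¹ * ·) ∆ F).card : ℝ) / F.card * (2 * ‖a‖) := by
  have h1 : ∑ h ∈ F, τ (α h⁻¹ (α g a)) = ∑ h ∈ F.image (g⁻¹ * ·), τ (α h⁻¹ a) := by
    rw [Finset.sum_image fun _ _ _ _ h => mul_left_cancel h]
    refine Finset.sum_congr rfl fun h _ => ?_
    change τ ((α h⁻¹ * α g) a) = _
    rw [← map_mul, mul_inv_rev, inv_inv]
  have h2 := norm_sum_sub_sum_le (F.image (g⁻¹ * ·)) F (f := fun h => τ (α h⁻¹ a))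
    (C := 2 * ‖a‖) fun h => (norm_trace_apply_le hτ _).trans (by
      gcongr
      exact NonUnitalStarAlgHom.norm_apply_le (α h⁻¹) a)
  rw [average_apply, average_apply, ← mul_sub, h1, norm_mul, norm_inv, Complex.norm_natCast,
    div_eq_inv_mul, mul_assoc]
  gcongr

/-- If a continuous affine function is less than `s` on the invariant traces, then one of its
averages over finite subsets of `G` is less than `s` on all traces: otherwise a weak* limit of
averages along a Følner sequence is an invariant trace with value at least `s`. -/
lemma exists_sum_lt (hG : IsAmenable G) (α : G →* (A ≃⋆ₐ[ℂ] A)) (c : A) {s : ℝ}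
    (hc : ∀ τ ∈ invTraceSpace α, (τ c).re < s) :
    ∃ (N : ℕ) (g : Fin N → G), 0 < N ∧
      ∀ τ ∈ traceSpace A, ∑ j, (τ (α (g j) c)).re < N * s := by
  classical
  obtain ⟨F, hF, hinv⟩ := hG
  by_contra! hcon
  set E : ℕ → Finset G := fun n => (hF n).1.toFinset with hE
  have hEne (n : ℕ) : (E n).Nonempty := (hF n).1.toFinset_nonempty.2 (hF n).2
  have hτ (n : ℕ) : ∃ τ ∈ traceSpace A, s ≤ (average α (E n) τ c).re := by
    obtain ⟨τ, hτ, h⟩ := hcon (E n).card (fun j => ((E n).equivFin.symm j : G)⁻¹) (hEne n).card_pos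
    refine ⟨τ, hτ, ?_⟩
    have e : ∑ j, (τ (α ((E n).equivFin.symm j : G)⁻¹ c)).re = ∑ g ∈ E n, (τ (α g⁻¹ c)).re := by
      rw [Equiv.sum_comp (E n).equivFin.symm fun g : E n => (τ (α (g : G)⁻¹ c)).re]
      exact Finset.sum_coe_sort (E n) fun g => (τ (α g⁻¹ c)).re
    rw [e] at h
    have hpos : (0 : ℝ) < (E n).card := by exact_mod_cast (hEne n).card_pos
    rw [average_apply, ← Complex.ofReal_natCast, ← Complex.ofReal_inv, Complex.re_ofReal_mul,
      Complex.re_sum, ← div_eq_inv_mul, le_div_iff₀ hpos, mul_comm]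
    exact h
  choose τ hτT hτs using hτ
  obtain ⟨σ, hσT, hσ⟩ := isCompact_traceSpace.ultrafilter_le_nhds
    ((hyperfilter ℕ).map fun n => average α (E n) (τ n))
    (le_principal_iff.2 (mem_map.2 (univ_mem' fun n => average_mem α (hEne n) (hτT n))))
  have hlim (a : A) : Tendsto (fun n => average α (E n) (τ n) a) (hyperfilter ℕ) (𝓝 (σ a)) :=
    ((WeakDual.eval_continuous a).tendsto σ).comp hσ
  have hσinv : σ ∈ invTraceSpace α := by
    refine ⟨hσT, fun g a => ?_⟩
    rw [← sub_eq_zero]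
    refine tendsto_nhds_unique ((hlim (α g a)).sub (hlim a)) ?_
    refine Tendsto.mono_left ?_ Nat.hyperfilter_le_atTop
    have h := (hinv g⁻¹).mul_const (2 * ‖a‖)
    rw [zero_mul] at h
    refine squeeze_zero_norm (fun n => ?_) h
    refine (norm_average_sub_le α (E n) (hτT n) g a).trans_eq ?_
    have e1 : (E n : Set G) = F n := (hF n).1.coe_toFinset
    have e2 : (((E n).image (g⁻¹ * ·) ∆ E n : Finset G) : Set G) = (g⁻¹ • F n) ∆ F n := by
      rw [Finset.coe_symmDiff, Finset.coe_image, e1]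
      rfl
    rw [← e2, Set.ncard_coe_finset, ← e1, Set.ncard_coe_finset]
  refine (hc σ hσinv).not_ge ?_
  exact ge_of_tendsto ((Complex.continuous_re.tendsto _).comp (hlim c))
    (Eventually.of_forall hτs)

end Averaging

/-! ### Dynamical comparison -/

section Comparison

variable {A : Type u} [CStarAlgebra A] [PartialOrder A] [StarOrderedRing A]
  {G : Type v} [Group G] {α : G →* (A ≃⋆ₐ[ℂ] A)} {a b y : Stabilization A}

lemma AllRanksRealized.exists_dimFun_eq (hranks : AllRanksRealized A) (c : A)
    (hc : ∀ τ ∈ traceSpace A, 0 < (τ c).re) :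
    ∃ x : Stabilization A, 0 ≤ x ∧
      ∀ τ ∈ traceSpace A, dimFun τ x = ENNReal.ofReal (τ c).re := by
  refine hranks (fun τ => ENNReal.ofReal (τ c).re) ?_ (fun τ hτ => ENNReal.ofReal_pos.2 (hc τ hτ))
    fun σ hσ τ hτ s t hs ht _ => ?_
  · exact (ENNReal.continuous_ofReal.comp (Complex.continuous_re.comp
      (WeakDual.eval_continuous c))).lowerSemicontinuous.lowerSemicontinuousOn _
  · have e : (((s : ℂ) • σ + (t : ℂ) • τ) c).re = s * (σ c).re + t * (τ c).re := by
      change ((s : ℂ) • σ c + (t : ℂ) • τ c).re = _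
      simp
    rw [e, ENNReal.ofReal_add (mul_nonneg hs (hc σ hσ).le) (mul_nonneg ht (hc τ hτ).le),
      ENNReal.ofReal_mul hs, ENNReal.ofReal_mul ht]

lemma StrictComparison.cuntzLE (hcomp : StrictComparison A) (hT : (traceSpace A).Nonempty)
    (ha : 0 ≤ a) (hb : 0 ≤ b) (h : ∀ τ ∈ traceSpace A, dimFun τ a < dimFun τ b) :
    CuntzLE a b := by
  refine hcomp a b ha hb ?_ h
  rintro rfl
  obtain ⟨τ, hτ⟩ := hT
  exact not_lt_zero ((h τ hτ).trans_eq (dimFun_zero τ))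

lemma dimFun_dirSum_const {τ : WeakDual ℂ A} (hτ : τ ∈ traceSpace A) {x : Stabilization A}
    (hx : 0 ≤ x) {N : ℕ} (hN : 0 < N) {c : A}
    (h : dimFun τ x = ENNReal.ofReal (τ ((N : ℝ)⁻¹ • c)).re) :
    dimFun τ (dirSum fun _ : Fin N => x) = ENNReal.ofReal (τ c).re := by
  have hN' : (N : ℝ) ≠ 0 := by positivity
  rw [dimFun_dirSum hτ fun _ => hx, Finset.sum_const, Finset.card_univ, Fintype.card_fin, h,
    re_smul, nsmul_eq_mul, ← ENNReal.ofReal_natCast, ← ENNReal.ofReal_mul (by positivity),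
    mul_inv_cancel_left₀ hN']

lemma dimFun_dirSum_stabAct {τ : WeakDual ℂ A} (hτ : τ ∈ traceSpace A) {x : Stabilization A}
    (hx : 0 ≤ x) {N : ℕ} (g : Fin N → G) {c : A}
    (hc : ∀ τ ∈ traceSpace A, 0 ≤ (τ c).re)
    (h : ∀ τ ∈ traceSpace A, dimFun τ x = ENNReal.ofReal (τ ((N : ℝ)⁻¹ • c)).re) :
    dimFun τ (dirSum fun j => stabAct α (g j) x) =
      ENNReal.ofReal ((N : ℝ)⁻¹ * ∑ j, (τ (α (g j) c)).re) := by
  have hpos (j : Fin N) : 0 ≤ (N : ℝ)⁻¹ * (τ (α (g j) c)).re :=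
    mul_nonneg (by positivity) (hc _ (pullback_mem (α (g j)) hτ))
  rw [dimFun_dirSum hτ fun j => stabAct_nonneg α (g j) hx, Finset.mul_sum,
    ENNReal.ofReal_sum_of_nonneg fun j _ => hpos j]
  refine Finset.sum_congr rfl fun j _ => ?_
  rw [dimFun_stabAct α _ hx, h _ (pullback_mem _ hτ), re_smul, pullback_apply]

/-- An element of rank less than the constant `s` on the invariant traces is dynamically below an
element of constant rank `s`. -/
lemma elemDynLE_of_dimFun_le (hG : IsAmenable G) (hcomp : StrictComparison A)
    (hranks : AllRanksRealized A) (hT : (traceSpace A).Nonempty) (ha : 0 ≤ a) (hy : 0 ≤ y)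
    {S s : ℝ} (hS : 0 ≤ S) (hSs : S < s)
    (hya : ∀ τ ∈ traceSpace A, dimFun τ y = ENNReal.ofReal s)
    (h : ∀ τ ∈ invTraceSpace α, dimFun τ a ≤ ENNReal.ofReal S) : ElemDynLE α a y := by
  intro ε hε
  obtain ⟨c, hc, hcs⟩ := exists_dimFun_cutDown_lt ha hε hS hSs
  have hcpos : ∀ τ ∈ traceSpace A, 0 < (τ c).re := fun τ hτ =>
    ENNReal.ofReal_pos.1 (bot_le.trans_lt (hc τ hτ))
  obtain ⟨N, g, hN, hg⟩ := exists_sum_lt hG α c fun τ hτ => hcs τ hτ.1 (h τ hτ)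
  have hN' : (0 : ℝ) < N := by exact_mod_cast hN
  obtain ⟨x, hx, hxc⟩ := hranks.exists_dimFun_eq ((N : ℝ)⁻¹ • c) fun τ hτ => by
    rw [re_smul]
    exact mul_pos (by positivity) (hcpos τ hτ)
  have hpos := stabAct_nonneg α (a := x) (ha := hx)
  have hrank (τ) (hτ : τ ∈ traceSpace A) :=
    dimFun_dirSum_stabAct (α := α) hτ hx g (fun τ hτ => (hcpos τ hτ).le) hxc
  -- the average of `c`, as an element of `A`
  set k : A := (N : ℝ)⁻¹ • ∑ j, α (g j) c with hk
  have hkτ (τ : WeakDual ℂ A) : (τ k).re = (N : ℝ)⁻¹ * ∑ j, (τ (α (g j) c)).re := by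
    rw [hk, re_smul, map_sum, Complex.re_sum]
  have hk0 (τ) (hτ : τ ∈ traceSpace A) : 0 ≤ (τ k).re := by
    rw [hkτ]
    exact mul_nonneg (by positivity)
      (Finset.sum_nonneg fun j _ => (hcpos _ (pullback_mem (α (g j)) hτ)).le)
  obtain ⟨n, hn⟩ := exists_lt_partialTrace isCompact_traceSpace subset_rfl hy k hk0
    fun τ hτ => by
      rw [hya τ hτ, ENNReal.ofReal_lt_ofReal_iff (hS.trans_lt hSs), hkτ, inv_mul_lt_iff₀ hN']
      exact hg τ hτ
  obtain ⟨δ, hδ, hyδ⟩ := exists_traceExt_le_dimFun_cutDown hy n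
  refine ⟨δ, hδ, N, fun j => (g j)⁻¹, fun j => stabAct α (g j) x, fun j => hpos (g j), ?_, ?_⟩
  · simp only [stabAct_inv_stabAct]
    refine hcomp.cuntzLE hT (cutDown_nonneg a ε) (dirSum_nonneg fun _ => hx) fun τ hτ => ?_
    rw [dimFun_dirSum_const hτ hx hN (hxc τ hτ)]
    exact hc τ hτ
  · refine hcomp.cuntzLE hT (dirSum_nonneg fun j => hpos (g j)) (cutDown_nonneg y δ)
      fun τ hτ => ?_
    rw [hrank τ hτ, ← hkτ]
    refine lt_of_lt_of_le ?_ ((ofReal_re_partialTrace_le hτ (cfcₙ_rampFun_nonneg n y) n).trans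
      (hyδ τ hτ))
    rw [ENNReal.ofReal_lt_ofReal_iff_of_nonneg (hk0 τ hτ)]
    exact hn n le_rfl τ hτ

lemma isCompact_invTraceSpace (α : G →* (A ≃⋆ₐ[ℂ] A)) : IsCompact (invTraceSpace α) := by
  have e : invTraceSpace α = traceSpace A ∩ ⋂ g, ⋂ a, {τ | τ (α g a) = τ a} := by
    ext τ
    simp [invTraceSpace]
  rw [e]
  exact isCompact_traceSpace.inter_right (isClosed_iInter fun g => isClosed_iInter fun a =>
    isClosed_eq (WeakDual.eval_continuous _) (WeakDual.eval_continuous _))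

/-- An element of constant rank `s` is dynamically below an element whose rank on the invariant
traces is greater than `s`. -/
lemma elemDynLE_of_lt_dimFun (hG : IsAmenable G) (hA : IsSimpleCStar A)
    (hcomp : StrictComparison A) (hranks : AllRanksRealized A) (hT : (traceSpace A).Nonempty)
    (hy : 0 ≤ y) (hb : 0 ≤ b) (hb0 : b ≠ 0) {s s' : ℝ} (hs : 0 < s) (hss : s < s')
    (hya : ∀ τ ∈ traceSpace A, dimFun τ y = ENNReal.ofReal s)
    (h : ∀ τ ∈ invTraceSpace α, ENNReal.ofReal s' < dimFun τ b) : ElemDynLE α y b := by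
  intro ε hε
  have hτs (τ) (hτ : τ ∈ traceSpace A) (r : ℝ) : (τ (r • (1 : A))).re = r := by
    rw [re_smul, hτ.1, Complex.one_re, mul_one]
  obtain ⟨n₁, hn₁⟩ := exists_lt_partialTrace (isCompact_invTraceSpace α) (fun τ hτ => hτ.1) hb
    (s' • (1 : A)) (fun τ hτ => by rw [hτs τ hτ.1]; linarith)
    (fun τ hτ => by rw [hτs τ hτ.1]; exact h τ hτ)
  obtain ⟨n₂, hn₂⟩ := exists_lt_partialTrace isCompact_traceSpace subset_rfl hb 0
    (fun τ hτ => by simp) (fun τ hτ => by simpa using dimFun_pos hA hτ hb hb0)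
  set n := max n₁ n₂
  set k := partialTrace n (cfcₙ (rampFun n) b) with hk
  obtain ⟨σ, hσT, hσ⟩ := isCompact_traceSpace.exists_isMinOn hT
    (Complex.continuous_re.comp (WeakDual.eval_continuous k)).continuousOn
  have hσ0 : 0 < (σ k).re := by simpa using hn₂ n (le_max_right _ _) σ hσT
  -- lowering `k` by `η` makes the second comparison below strict
  set η := min ((σ k).re / 2) ((s' - s) / 2)
  have hη0 : 0 < η := lt_min (by linarith) (by linarith)
  have hη1 : η ≤ (σ k).re / 2 := min_le_left _ _
  have hη2 : η ≤ (s' - s) / 2 := min_le_right _ _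
  set c : A := k - η • 1 with hc
  have hcτ (τ) (hτ : τ ∈ traceSpace A) : (τ c).re = (τ k).re - η := by
    rw [hc, map_sub, Complex.sub_re, hτs τ hτ]
  have hcpos (τ) (hτ : τ ∈ traceSpace A) : 0 < (τ c).re := by
    have : (σ k).re ≤ (τ k).re := hσ hτ
    rw [hcτ τ hτ]
    linarith
  obtain ⟨N, g, hN, hg⟩ := exists_sum_lt hG α (-c) (s := -s) fun τ hτ => by
    have := hn₁ n (le_max_left _ _) τ hτ
    rw [hτs τ hτ.1] at this
    rw [map_neg, Complex.neg_re, hcτ τ hτ.1]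
    linarith
  have hN' : (0 : ℝ) < N := by exact_mod_cast hN
  obtain ⟨x, hx, hxc⟩ := hranks.exists_dimFun_eq ((N : ℝ)⁻¹ • c) fun τ hτ => by
    rw [re_smul]
    exact mul_pos (by positivity) (hcpos τ hτ)
  obtain ⟨δ, hδ, hbδ⟩ := exists_traceExt_le_dimFun_cutDown hb n
  refine ⟨δ, hδ, N, g, fun _ => x, fun _ => hx, ?_, ?_⟩
  · refine hcomp.cuntzLE hT (cutDown_nonneg y ε)
      (dirSum_nonneg fun j => stabAct_nonneg α (g j) hx) fun τ hτ => ?_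
    rw [dimFun_dirSum_stabAct hτ hx g (fun τ hτ => (hcpos τ hτ).le) hxc]
    obtain ⟨m, hm⟩ := exists_nat_ge (2 / ε)
    have h1 := (dimFun_cutDown_le hτ hy hε ((div_le_iff₀ hε).1 hm)).trans
      (traceExt_cfcₙ_rampFun_le_dimFun τ y m)
    rw [hya τ hτ] at h1
    refine h1.trans_lt ?_
    have h2 := hg τ hτ
    simp only [map_neg, Complex.neg_re, Finset.sum_neg_distrib, mul_neg, neg_lt_neg_iff] at h2
    have h3 : s < (N : ℝ)⁻¹ * ∑ j, (τ (α (g j) c)).re := by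
      rwa [lt_inv_mul_iff₀ hN']
    exact (ENNReal.ofReal_lt_ofReal_iff (hs.trans h3)).2 h3
  · refine hcomp.cuntzLE hT (dirSum_nonneg fun _ => hx) (cutDown_nonneg b δ) fun τ hτ => ?_
    rw [dimFun_dirSum_const hτ hx hN (hxc τ hτ)]
    refine lt_of_lt_of_le ?_ ((ofReal_re_partialTrace_le hτ (cfcₙ_rampFun_nonneg n b) n).trans
      (hbδ τ hτ))
    rw [ENNReal.ofReal_lt_ofReal_iff_of_nonneg (hcpos τ hτ).le, hcτ τ hτ]
    linarith

/-- Without traces, strict comparison makes every positive element Cuntz subequivalent to every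
nonzero one. -/
lemma elemDynLE_of_traceSpace_eq_empty (hcomp : StrictComparison A) (hT : traceSpace A = ∅)
    (hb : 0 ≤ b) (hb0 : b ≠ 0) : ElemDynLE α a b := by
  intro ε hε
  have hcuntz {p q : Stabilization A} (hp : 0 ≤ p) (hq : 0 ≤ q) (hq0 : q ≠ 0) : CuntzLE p q :=
    hcomp p q hp hq hq0 (by simp [hT])
  obtain ⟨m, hm⟩ := exists_cfcₙ_rampFun_ne_zero hb hb0
  obtain ⟨δ, hδ, n, hn⟩ := exists_cfcₙ_rampFun_le_cutDown hb m
  have hone : stabAct α 1 b = b := ext_entry fun i j => by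
    rw [stabAct, entry_map, map_one]
    rfl
  refine ⟨δ, hδ, 1, fun _ => 1, fun _ => b, fun _ => hb,
    hcuntz (cutDown_nonneg a ε) (dirSum_nonneg fun _ => stabAct_nonneg α 1 hb) fun h => hb0 ?_,
    hcuntz (dirSum_nonneg fun _ => hb) (cutDown_nonneg b δ) fun h => hm ?_⟩
  · simp only [hone, dirSum, Finset.univ_unique, Finset.sum_singleton] at h
    refine eq_zero_of_entry fun i j => ?_
    have h1 := entry_shift 0 b (Nat.pair 0 i) (Nat.pair 0 j)
    simp only [Nat.unpair_pair, and_self, if_true] at h1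
    rw [← h1]
    change entry _ _ (shift 0 b) = 0
    rw [show shift 0 b = 0 from h, map_zero]
  · rw [h, cfcₙ_apply_zero] at hn
    exact le_antisymm hn (cfcₙ_rampFun_nonneg m b)

lemma ElemDynLE.dynLE (ha : 0 ≤ a) (hb : 0 ≤ b) (h : ElemDynLE α a b) : DynLE α a b :=
  ⟨1, ![a, b], fun i => by fin_cases i <;> simpa, rfl, rfl, fun i => by fin_cases i; simpa⟩

lemma ElemDynLE.trans_dynLE (ha : 0 ≤ a) (hy : 0 ≤ y) (hb : 0 ≤ b) (h₁ : ElemDynLE α a y)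
    (h₂ : ElemDynLE α y b) : DynLE α a b :=
  ⟨2, ![a, y, b], fun i => by fin_cases i <;> simpa, rfl, rfl,
    fun i => by fin_cases i <;> simpa⟩

end Comparison

end DynComp

end

theorem theorem3p9
    {G : Type*} [Group G] [Countable G] (hG : DynComp.IsAmenable G)
    {A : Type*} [CStarAlgebra A] [PartialOrder A] [StarOrderedRing A]
    [TopologicalSpace.SeparableSpace A]
    (hsimple : DynComp.IsSimpleCStar A)
    (hcomp : DynComp.StrictComparison A)
    (hQT : DynComp.QuasitracesAreTraces A)
    (hranks : DynComp.AllRanksRealized A)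
    (α : G →* (A ≃⋆ₐ[ℂ] A)) :
    DynComp.WeakDynamicalComparison α := by
  intro a b ha hb hb0 hab
  rcases (DynComp.traceSpace A).eq_empty_or_nonempty with hT | hT
  · exact (DynComp.elemDynLE_of_traceSpace_eq_empty hcomp hT hb hb0).dynLE ha hb
  obtain ⟨S, hS, hab⟩ := ENNReal.lt_iff_exists_nnreal_btwn.1 hab
  obtain ⟨s, hs, hab⟩ := ENNReal.lt_iff_exists_nnreal_btwn.1 hab
  obtain ⟨s', hs', hab⟩ := ENNReal.lt_iff_exists_nnreal_btwn.1 hab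
  have hSs : (S : ℝ) < s := by exact_mod_cast hs
  have hs0 : (0 : ℝ) < s := S.coe_nonneg.trans_lt hSs
  have hone (τ) (hτ : τ ∈ DynComp.traceSpace A) : (τ ((s : ℝ) • (1 : A))).re = s := by
    rw [DynComp.re_smul, hτ.1, Complex.one_re, mul_one]
  obtain ⟨y, hy, hys⟩ := hranks.exists_dimFun_eq ((s : ℝ) • (1 : A)) fun τ hτ => by
    rwa [hone τ hτ]
  have hys' (τ) (hτ : τ ∈ DynComp.traceSpace A) : DynComp.dimFun τ y = ENNReal.ofReal s := by
    rw [hys τ hτ, hone τ hτ]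
  refine (DynComp.elemDynLE_of_dimFun_le hG hcomp hranks hT ha hy S.coe_nonneg hSs hys'
    fun τ hτ => ?_).trans_dynLE ha hy hb
    (DynComp.elemDynLE_of_lt_dimFun hG hsimple hcomp hranks hT hy hb hb0 (s' := s') hs0
      (by exact_mod_cast hs') hys' fun τ hτ => ?_)
  · rw [ENNReal.ofReal_coe_nnreal]
    exact (le_iSup₂ (f := fun τ _ => DynComp.dimFun τ a) τ hτ).trans hS.le
  · rw [ENNReal.ofReal_coe_nnreal]
    exact hab.trans_le (iInf₂_le (f := fun τ _ => DynComp.dimFun τ b) τ hτ)
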